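/- Let $R$ (red) and $B$ (blue) be disjoint finite sets of points in the Euclidean plane with $|R|=|B|=n\ge 1$, and put $S=R\cup B$. Say that $S$ is in strong general position if no three points of $S$ are collinear and no two different pairs of points of $S$ define parallel lines. A set $H$ of rays from $S$ consists of one ray $\{p+tv_p : t\ge 0\}$, $v_p\neq 0$, for every $p\in S$; each ray inherits the color of its apex $p$. For pairwise-disjoint rays, let $C(S,H)$ be the circular sequence of $2n$ colors induced by the rays at infinity, taken in clockwise order (equivalently, the colors of the rays in the clockwise order in which they cross a circle enclosing $S$). Its alternation number is the number $k$ such that $C(S,H)$ splits cyclically into $2k$ maximal monochromatic blocks ($k$ red and $k$ blue). **Theorem.** There are absolute constants $c,K>0$ with the following two properties. 1. For every $n\ge 1$ and all disjoint $R,B$ with $|R|=|B|=n$ such that $S=R\cup B$ is in strong general position, there is a set $H$ of pairwise-disjoint rays from $S$ such that the alternation number of $C(S,H)$ is at least $c\sqrt n$. 2. This bound is tight: for every $n\ge 1$ there are disjoint $R,B$ with $|R|=|B|=n$ and $S=R\cup B$ in strong general position such that, for every set $H$ of pairwise-disjoint rays from $S$, the alternation number of $C(S,H)$ is at most $K\sqrt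 n$. -/

import Mathlib

namespace ColoredRays

/-- The Euclidean plane. -/
abbrev Plane : Type := EuclideanSpace ℝ (Fin 2)

inductive Color : Type
  | red
  | blue

/-- The ray `h(p, v)` with apex `p` and direction vector `v` (a ray when `v ≠ 0`). -/
def ray (p v : Plane) : Set Plane := {x | ∃ t : ℝ, 0 ≤ t ∧ x = p + t • v}

/-- General position: no three distinct points of `S` are collinear. -/
def GeneralPosition (S : Finset Plane) : Prop :=
  ∀ p ∈ S, ∀ q ∈ S, ∀ u ∈ S, p ≠ q → p ≠ u → q ≠ u →
    ¬ Collinear ℝ ({p, q, u} : Set Plane)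

/-- Strong general position: general position, and different pairs of points of `S`
never span parallel lines. -/
def StrongGeneralPosition (S : Finset Plane) : Prop :=
  GeneralPosition S ∧
    ∀ p ∈ S, ∀ q ∈ S, ∀ u ∈ S, ∀ w ∈ S, p ≠ q → u ≠ w →
      ({p, q} : Set Plane) ≠ {u, w} →
      ¬ (AffineSubspace.Parallel
          (affineSpan ℝ ({p, q} : Set Plane)) (affineSpan ℝ ({u, w} : Set Plane)))

/-- `d` assigns to every point `p` of `S` a nonzero vector, and the rays `h(p, d p)`, one from
each point of `S`, are pairwise disjoint. -/
def IsDisjointRaySystem (S : Finset Plane) (d : Plane → Plane) : Prop :=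
  (∀ p ∈ S, d p ≠ 0) ∧
    ∀ p ∈ S, ∀ q ∈ S, p ≠ q → Disjoint (ray p (d p)) (ray q (d q))

/-- The angle, in `(-π, π]`, of the direction of the vector `v` with the positive `x`-axis. -/
noncomputable def directionAngle (v : Plane) : ℝ := Complex.arg ⟨v 0, v 1⟩

/-- The signed distance, positive to the left, from the origin-based directed line of
direction `v` to the point `p`. -/
noncomputable def leftOffset (p v : Plane) : ℝ := (v 0 * p 1 - v 1 * p 0) / ‖v‖

/-- The position at infinity of the ray `h(p, v)`: the angle of its direction, then, to
separate rays with the same direction, its position from right to left. Along a sufficiently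
large circle, disjoint rays are met counterclockwise in the (cyclic) order of increasing
position, and clockwise in the order of decreasing position. -/
noncomputable def positionAtInfinity (p v : Plane) : ℝ ×ₗ ℝ :=
  toLex (directionAngle v, leftOffset p v)

open Classical in
/-- The points of `S`, listed in the clockwise order at infinity of the rays `h(p, d p)`. -/
noncomputable def clockwiseList (S : Finset Plane) (d : Plane → Plane) : List Plane :=
  S.toList.insertionSort
    (fun p q => positionAtInfinity q (d q) ≤ positionAtInfinity p (d p))

open Classical in
/-- The color of a point: red on `R`, blue elsewhere. -/
noncomputable def colorOf (R : Finset Plane) (p : Plane) : Color :=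
  if p ∈ R then Color.red else Color.blue

open Classical in
/-- `C(S, H)` for `S = R ∪ B` and `H = {h(p, d p) | p ∈ S}`: the circular sequence of colors
induced at infinity, in clockwise order, by the rays, each having the color of its apex. -/
noncomputable def circularSequence (R B : Finset Plane) (d : Plane → Plane) : Cycle Color :=
  (((clockwiseList (R ∪ B) d).map (colorOf R) : List Color) : Cycle Color)

open Classical in
/-- The number of cyclic positions of the list `l` at which a red element is immediately
followed by a blue one. -/
noncomputable def redBlueChanges (l : List Color) : ℕ :=
  (l.zip (l.rotate 1)).count (Color.red, Color.blue)

theorem redBlueChanges_eq_of_isRotated (l₁ l₂ : List Color) (h : l₁ ~r l₂) :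
    redBlueChanges l₁ = redBlueChanges l₂ := by
  classical
  obtain ⟨n, rfl⟩ := h
  have key : (l₁.rotate n).zip ((l₁.rotate n).rotate 1) = (l₁.zip (l₁.rotate 1)).rotate n := by
    rw [List.rotate_rotate, Nat.add_comm, ← List.rotate_rotate]
    simp only [List.zip]
    rw [List.zipWith_rotate_distrib]
    simp
  unfold redBlueChanges
  rw [key]
  exact ((List.rotate_perm _ n).count_eq _).symm

/-- The alternation number of a circular sequence in which both colors occur: the number `k`
such that it splits cyclically into `2k` maximal monochromatic blocks, alternately red and blue
(every red block ends at exactly one change from red to blue). -/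
noncomputable def alternationNumber (C : Cycle Color) : ℕ :=
  Quotient.liftOn C redBlueChanges redBlueChanges_eq_of_isRotated

end ColoredRays

/-! Lower bound. After a shear all abscissas are distinct, and some vertical line has `n / 2` points
of one colour weakly to its left and `n / 2` of the other colour to its right. A matching of minimum
total length between these sets has no crossings, so its segments meet the line at distinct heights;
strong general position makes their slopes distinct. By Erdős–Szekeres, about `√(n / 2)` of the
segments have slopes monotone in the height. If the slopes increase, let the left ends shoot to the
right along their segments, with slightly smaller slopes: the higher rays are steeper, so they stay
disjoint, and every right end lies strictly between the ray of its partner and the next ray. If the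
slopes decrease, a half turn reverses the heights, keeps the slopes and exchanges the two kinds of
ends. All other points can then be given rightward rays one at a time (`Frame.exists_cut`). Far to
the right, disjoint rightward rays are ordered by slope, so left and right ends alternate at
infinity (`Frame.exists_fan_alternating`).

Upper bound. Place the blue points very close to the origin and the red ones in `m ≈ √n` tiny disks,
at most `m` in each. Charge a change from a red ray `r` to a blue ray `b` to a disk met by `b`, if
there is one; otherwise to the index of `r` in its disk, if `r` points almost to the origin;
otherwise to the disk of `r` and the side of the central direction to which `r` turns. Two blue rays
through one disk cross, two central red rays from different disks cross, and a blue ray missing a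
disk cannot separate at infinity two noncentral red rays leaving that disk on the same side
(`not_position_between`). No label is used twice, and there are `4 * m` labels. -/

open Filter Topology

namespace ColoredRays

/-! ### Colour changes in lists -/

open Classical in
/-- The number of positions of the list `l` at which a red element is immediately followed by a
blue one, without wrapping around. -/
noncomputable def linearChanges (l : List Color) : ℕ :=
  (l.zip l.tail).count (Color.red, Color.blue)

open Classical in
theorem linearChanges_cons_cons (a b : Color) (t : List Color) :
    linearChanges (a :: b :: t) =
      linearChanges (b :: t) + if a = Color.red ∧ b = Color.blue then 1 else 0 := by
  simp [linearChanges, List.count_cons, Prod.ext_iff]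

theorem linearChanges_singleton (a : Color) : linearChanges [a] = 0 := by
  simp [linearChanges]

open Classical in
theorem linearChanges_cons_le (a b : Color) (t : List Color) :
    linearChanges (a :: t) ≤ linearChanges (a :: b :: t) := by
  cases t with
  | nil => simp [linearChanges_singleton]
  | cons c t =>
    simp only [linearChanges_cons_cons]
    cases a <;> cases b <;> cases c <;> simp

theorem linearChanges_blue_cons (t : List Color) :
    linearChanges (Color.blue :: t) = linearChanges t := by
  cases t with
  | nil => simp [linearChanges]
  | cons c t => simp [linearChanges_cons_cons]

/-- An arbitrary first letter is carried along so that the induction controls the pair formed at the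
junction. -/
theorem linearChanges_cons_le_of_sublist {m l : List Color} (h : m.Sublist l) :
    ∀ a, linearChanges (a :: m) ≤ linearChanges (a :: l) := by
  induction h with
  | slnil => intro a; exact le_rfl
  | cons b _ ih =>
    intro a
    refine (ih a).trans (linearChanges_cons_le a b _)
  | cons_cons b _ ih =>
    intro a
    simp only [linearChanges_cons_cons]
    have := ih b
    omega

theorem linearChanges_le_of_sublist {m l : List Color} (h : m.Sublist l) :
    linearChanges m ≤ linearChanges l := by
  simpa [linearChanges_blue_cons] using linearChanges_cons_le_of_sublist h Color.blue

open Classical in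
theorem redBlueChanges_cons (a : Color) (t : List Color) :
    redBlueChanges (a :: t) = linearChanges (a :: (t ++ [a])) := by
  have key : ∀ (t : List Color) (a c : Color),
      (a :: t).zip (t ++ [c]) = (a :: (t ++ [c])).zip (t ++ [c]) := by
    intro t
    induction t with
    | nil => intro a c; simp
    | cons b t ih => intro a c; simpa using ih b c
  have h : (a :: t).rotate 1 = t ++ [a] := by simp
  rw [redBlueChanges, h, key, linearChanges, List.tail_cons]

theorem linearChanges_le_redBlueChanges (l : List Color) :
    linearChanges l ≤ redBlueChanges l := by
  cases l with
  | nil => simp [linearChanges]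
  | cons a t =>
    rw [redBlueChanges_cons]
    refine linearChanges_le_of_sublist ?_
    simp

theorem linearChanges_append_singleton (l : List Color) (a : Color) :
    linearChanges (l ++ [a]) ≤ linearChanges l + 1 := by
  induction l with
  | nil => simp [linearChanges]
  | cons b t ih =>
    cases t with
    | nil => simp [linearChanges_cons_cons, linearChanges_singleton]; split_ifs <;> omega
    | cons c t =>
      simp only [List.cons_append, linearChanges_cons_cons] at ih ⊢
      omega

theorem redBlueChanges_le (l : List Color) : redBlueChanges l ≤ linearChanges l + 1 := by
  cases l with
  | nil => simp [redBlueChanges]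
  | cons a t =>
    rw [redBlueChanges_cons]
    exact linearChanges_append_singleton (a :: t) a

theorem one_le_redBlueChanges {l : List Color} (hr : Color.red ∈ l) (hb : Color.blue ∈ l) :
    1 ≤ redBlueChanges l := by
  obtain ⟨s, t, rfl⟩ := List.append_of_mem hr
  -- Rotated to start with a red letter, the word has some blue letter later on, hence a change
  -- already without wrapping around.
  have hrot : (s ++ Color.red :: t) ~r (Color.red :: t ++ s) :=
    ⟨s.length, by simp⟩
  rw [redBlueChanges_eq_of_isRotated _ _ hrot]
  refine le_trans ?_ (linearChanges_le_redBlueChanges _)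
  have hb' : Color.blue ∈ t ++ s := by
    simp at hb ⊢; tauto
  have : [Color.red, Color.blue].Sublist (Color.red :: t ++ s) := by
    simpa using hb'
  refine le_trans ?_ (linearChanges_le_of_sublist this)
  simp [linearChanges_cons_cons]

theorem zip_tail_pairwise {α β : Type*} [Preorder β] (f : α → β) (l : List α)
    (hs : l.Pairwise (fun a b => f b ≤ f a)) (hn : l.Nodup) :
    (l.zip l.tail).Pairwise (fun x y => f x.2 ≤ f x.1 ∧ f y.1 ≤ f x.2 ∧ f y.2 ≤ f y.1 ∧
      x.1 ≠ y.1 ∧ x.2 ≠ y.2) := by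
  induction l with
  | nil => simp
  | cons a t ih =>
    cases t with
    | nil => simp
    | cons b t =>
      have ih' := ih hs.of_cons hn.of_cons
      have hle : ∀ y ∈ (b :: t).zip t, f y.2 ≤ f y.1 := by
        clear ih ih' hn
        have h2 := hs.of_cons
        clear hs
        induction t generalizing b with
        | nil => simp
        | cons c t ih2 =>
          intro y hy
          simp only [List.zip_cons_cons, List.mem_cons] at hy
          rcases hy with rfl | hy
          · exact List.rel_of_pairwise_cons h2 (by simp)
          · exact ih2 c h2.of_cons y hy
      simp only [List.tail_cons, List.zip_cons_cons, List.pairwise_cons]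
      refine ⟨?_, by simpa using ih'⟩
      rintro ⟨y1, y2⟩ hy
      obtain ⟨h1, h2⟩ := List.of_mem_zip hy
      refine ⟨List.rel_of_pairwise_cons hs (by simp), ?_, hle _ hy, ?_, ?_⟩
      · rcases List.mem_cons.1 h1 with rfl | h1
        · exact le_rfl
        · exact List.rel_of_pairwise_cons hs.of_cons h1
      · rintro rfl
        exact (List.nodup_cons.1 hn).1 h1
      · rintro rfl
        exact (List.nodup_cons.1 hn.of_cons).1 h2

-- The charging principle for the upper bound: labels that separate any two changes occurring in
-- sorted order make the changes inject into the label set.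
open Classical in
theorem linearChanges_map_le_card {α β ι : Type*} [Preorder β] [Fintype ι] (f : α → β)
    (col : α → Color) (lab : α → α → ι) (l : List α)
    (hs : l.Pairwise (fun a b => f b ≤ f a)) (hn : l.Nodup)
    (hlab : ∀ a ∈ l, ∀ b ∈ l, ∀ a' ∈ l, ∀ b' ∈ l, col a = Color.red → col b = Color.blue →
      col a' = Color.red → col b' = Color.blue → a ≠ a' → b ≠ b' → f b ≤ f a → f a' ≤ f b →
      f b' ≤ f a' → lab a b ≠ lab a' b') :
    linearChanges (l.map col) ≤ Fintype.card ι := by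
  set P : α × α → Bool := fun x => decide (col x.1 = Color.red ∧ col x.2 = Color.blue) with hP
  have h1 : linearChanges (l.map col) = ((l.zip l.tail).filter P).length := by
    rw [linearChanges, ← List.map_tail, List.zip_map, List.count, List.countP_map,
      List.countP_eq_length_filter]
    congr 1
    apply List.filter_congr
    rintro ⟨a, b⟩ _
    rw [Bool.eq_iff_iff]
    simp [hP, Prod.ext_iff]
  rw [h1, ← List.length_map (f := fun x : α × α => lab x.1 x.2)]
  apply List.Nodup.length_le_card
  rw [List.Nodup, List.pairwise_map]
  have hz := (zip_tail_pairwise f l hs hn).filter P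
  refine hz.imp_of_mem ?_
  rintro ⟨a, b⟩ ⟨a', b'⟩ hx hy ⟨h2, h3, h4, h5, h6⟩
  rw [List.mem_filter] at hx hy
  obtain ⟨ha, hb⟩ := List.of_mem_zip hx.1
  obtain ⟨ha', hb'⟩ := List.of_mem_zip hy.1
  have hx2 := hx.2
  have hy2 := hy.2
  simp only [hP, decide_eq_true_eq] at hx2 hy2
  exact hlab a ha b (List.mem_of_mem_tail hb) a' ha' b' (List.mem_of_mem_tail hb')
    hx2.1 hx2.2 hy2.1 hy2.2 h5 h6 h2 h3 h4

/-! ### The clockwise list -/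

/-- The position at infinity of the ray assigned to `p`. -/
noncomputable abbrev key (d : Plane → Plane) (p : Plane) : ℝ ×ₗ ℝ :=
  positionAtInfinity p (d p)

open Classical in
theorem clockwiseList_pairwise (S : Finset Plane) (d : Plane → Plane) :
    (clockwiseList S d).Pairwise (fun a b => key d b ≤ key d a) := by
  have : Std.Total (fun p q => positionAtInfinity q (d q) ≤ positionAtInfinity p (d p)) :=
    ⟨fun a b => le_total _ _⟩
  have : IsTrans Plane (fun p q => positionAtInfinity q (d q) ≤ positionAtInfinity p (d p)) :=
    ⟨fun a b c h1 h2 => le_trans h2 h1⟩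
  exact List.pairwise_insertionSort _ _

open Classical in
theorem clockwiseList_perm (S : Finset Plane) (d : Plane → Plane) :
    (clockwiseList S d).Perm S.toList :=
  List.perm_insertionSort _ _

theorem mem_clockwiseList {S : Finset Plane} {d : Plane → Plane} {p : Plane} :
    p ∈ clockwiseList S d ↔ p ∈ S := by
  rw [(clockwiseList_perm S d).mem_iff, Finset.mem_toList]

theorem clockwiseList_nodup (S : Finset Plane) (d : Plane → Plane) :
    (clockwiseList S d).Nodup :=
  (clockwiseList_perm S d).nodup_iff.2 S.nodup_toList

open Classical in
theorem alternationNumber_circularSequence (R B : Finset Plane) (d : Plane → Plane) :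
    alternationNumber (circularSequence R B d) =
      redBlueChanges ((clockwiseList (R ∪ B) d).map (colorOf R)) := by
  simp only [circularSequence]
  rfl

-- For lower bounds only some of the points need to be followed, since deleting letters never
-- creates changes.
open Classical in
theorem linearChanges_le_alternationNumber {R B : Finset Plane} {d : Plane → Plane}
    (m : List Plane) (hm : ∀ p ∈ m, p ∈ R ∪ B)
    (hs : m.Pairwise (fun a b => key d b < key d a)) :
    linearChanges (m.map (colorOf R)) ≤ alternationNumber (circularSequence R B d) := by
  rw [alternationNumber_circularSequence]
  refine le_trans (linearChanges_le_of_sublist ?_) (linearChanges_le_redBlueChanges _)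
  refine List.Sublist.map _ ?_
  set l := clockwiseList (R ∪ B) d with hl
  have hmn : m.Nodup := hs.imp (fun h => by rintro rfl; exact lt_irrefl _ h)
  have hperm : (l.filter (fun p => decide (p ∈ m))).Perm m := by
    rw [List.perm_ext_iff_of_nodup ((clockwiseList_nodup _ _).filter _) hmn]
    intro a
    rw [List.mem_filter, decide_eq_true_eq, mem_clockwiseList]
    exact ⟨fun h => h.2, fun h => ⟨hm a h, h⟩⟩
  -- Both lists have the same elements and are sorted by the same key, which is injective on `m`.
  have heq : l.filter (fun p => decide (p ∈ m)) = m := by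
    refine List.Perm.eq_of_pairwise (le := fun a b => key d b ≤ key d a) ?_
      ((clockwiseList_pairwise _ _).filter _) (hs.imp le_of_lt) hperm
    intro a b ha hb h1 h2
    have ha' : a ∈ m := by simpa using (List.mem_filter.1 ha).2
    by_contra hab
    have hne : ∀ ⦃a⦄, a ∈ m → ∀ ⦃b⦄, b ∈ m → a ≠ b → key d a ≠ key d b := by
      have : Std.Symm (fun a b => key d a ≠ key d b) := ⟨fun _ _ h => h.symm⟩
      exact (hs.imp (S := fun a b => key d a ≠ key d b) (fun h => ne_of_gt h)).forall
    exact hne ha' hb hab (le_antisymm h2 h1)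
  rw [← heq]
  exact List.filter_sublist

theorem one_le_alternationNumber {R B : Finset Plane} (d : Plane → Plane)
    (hR : R.Nonempty) (hB : B.Nonempty) (hd : Disjoint R B) :
    1 ≤ alternationNumber (circularSequence R B d) := by
  classical
  rw [alternationNumber_circularSequence]
  obtain ⟨r, hr⟩ := hR
  obtain ⟨b, hb⟩ := hB
  apply one_le_redBlueChanges
  · refine List.mem_map.2 ⟨r, mem_clockwiseList.2 (Finset.mem_union_left _ hr), ?_⟩
    simp [colorOf, hr]
  · refine List.mem_map.2 ⟨b, mem_clockwiseList.2 (Finset.mem_union_right _ hb), ?_⟩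
    have : b ∉ R := Finset.disjoint_right.1 hd hb
    simp [colorOf, this]

/-- The extra `1` pays for the change that may occur between the last and the first letter. -/
theorem alternationNumber_le_card {ι : Type*} [Fintype ι] {R B : Finset Plane}
    (d : Plane → Plane) (lab : Plane → Plane → ι)
    (hlab : ∀ r ∈ R, ∀ b ∈ B, ∀ r' ∈ R, ∀ b' ∈ B, r ≠ r' → b ≠ b' →
      key d b ≤ key d r → key d r' ≤ key d b → key d b' ≤ key d r' → lab r b ≠ lab r' b') :
    alternationNumber (circularSequence R B d) ≤ Fintype.card ι + 1 := by
  classical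
  rw [alternationNumber_circularSequence]
  refine (redBlueChanges_le _).trans (Nat.succ_le_succ ?_)
  refine linearChanges_map_le_card (key d) _ lab _ (clockwiseList_pairwise _ _)
    (clockwiseList_nodup _ _) ?_
  have hred : ∀ p, colorOf R p = Color.red → p ∈ R := by
    intro p hp
    by_contra h
    simp [colorOf, h] at hp
  have hblue : ∀ p ∈ clockwiseList (R ∪ B) d, colorOf R p = Color.blue → p ∈ B := by
    intro p hp hc
    have : p ∉ R := fun h => by simp [colorOf, h] at hc
    rcases Finset.mem_union.1 (mem_clockwiseList.1 hp) with h | h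
    · exact absurd h this
    · exact h
  intro a _ b hb a' _ b' hb' h1 h2 h3 h4 h5 h6 h7 h8 h9
  exact hlab a (hred a h1) b (hblue b hb h2) a' (hred a' h3) b' (hblue b' hb' h4) h5 h6 h7 h8 h9


/-! ### Cross products and directions -/

/-- The cross product (signed area) of two plane vectors. -/
def cross (u v : Plane) : ℝ := u 0 * v 1 - u 1 * v 0

/-- The length of the plane vector `v`, computed in `ℂ`. -/
noncomputable def len (v : Plane) : ℝ := ‖(⟨v 0, v 1⟩ : ℂ)‖

theorem len_mul_cos (v : Plane) : len v * Real.cos (directionAngle v) = v 0 :=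
  Complex.norm_mul_cos_arg _

theorem len_mul_sin (v : Plane) : len v * Real.sin (directionAngle v) = v 1 :=
  Complex.norm_mul_sin_arg _

theorem plane_ext {u v : Plane} (h0 : u 0 = v 0) (h1 : u 1 = v 1) : u = v := by
  ext i
  fin_cases i
  · exact h0
  · exact h1

theorem len_pos {v : Plane} (hv : v ≠ 0) : 0 < len v := by
  refine norm_pos_iff.2 fun h => hv ?_
  rw [Complex.ext_iff] at h
  exact plane_ext (by simpa using h.1) (by simpa using h.2)

theorem len_eq_norm (v : Plane) : len v = ‖v‖ := by
  rw [len, EuclideanSpace.norm_eq, Fin.sum_univ_two, Complex.norm_def, Complex.normSq_mk]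
  simp [sq]

theorem cross_eq_sin (u v : Plane) :
    cross u v = len u * len v * Real.sin (directionAngle v - directionAngle u) := by
  rw [cross, ← len_mul_cos u, ← len_mul_cos v, ← len_mul_sin u, ← len_mul_sin v, Real.sin_sub]
  ring

theorem directionAngle_mem (v : Plane) : -Real.pi < directionAngle v ∧ directionAngle v ≤ Real.pi :=
  ⟨Complex.neg_pi_lt_arg _, Complex.arg_le_pi _⟩

/-- Within the open upper or the open lower half-plane two angles differ by at most `π` and the
branch cut is not met, so the sign of the sine orders them. -/
theorem directionAngle_lt_of_cross_pos {u v : Plane} (h : 0 < cross u v)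
    (hs : (0 < u 1 ∧ 0 < v 1) ∨ (u 1 < 0 ∧ v 1 < 0)) :
    directionAngle u < directionAngle v := by
  by_contra hcon
  push Not at hcon
  rw [cross_eq_sin] at h
  have hu := directionAngle_mem u
  have hv := directionAngle_mem v
  have hdiff : directionAngle u - directionAngle v ≤ Real.pi := by
    rcases hs with ⟨_, h2⟩ | ⟨h1, _⟩
    · have : 0 ≤ directionAngle v := Complex.arg_nonneg_iff.2 h2.le
      linarith
    · have : directionAngle u < 0 := Complex.arg_neg_iff.2 h1
      linarith
  have hsin : Real.sin (directionAngle v - directionAngle u) ≤ 0 :=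
    Real.sin_nonpos_of_nonpos_of_neg_pi_le (by linarith) (by linarith)
  have : 0 ≤ len u * len v := mul_nonneg (norm_nonneg _) (norm_nonneg _)
  nlinarith

theorem key_lt_of_directionAngle_lt {d : Plane → Plane} {p q : Plane}
    (h : directionAngle (d p) < directionAngle (d q)) : key d p < key d q :=
  Prod.Lex.toLex_lt_toLex.2 (Or.inl h)

/-! ### Frames -/

/-- A sheared coordinate frame of the plane, possibly rotated by a half turn. -/
structure Frame where
  sgn : ℝ
  shear : ℝ
  sgn_sq : sgn * sgn = 1

namespace Frame

/-- The abscissa in a frame. -/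
def X (F : Frame) (p : Plane) : ℝ := F.sgn * (p 0 + F.shear * p 1)

/-- The ordinate in a frame. -/
def Y (F : Frame) (p : Plane) : ℝ := F.sgn * p 1

/-- The frame rotated by a half turn. -/
def neg (F : Frame) : Frame := ⟨-F.sgn, F.shear, by rw [neg_mul_neg, F.sgn_sq]⟩

theorem neg_X (F : Frame) (p : Plane) : F.neg.X p = -F.X p := by simp [X, neg]

theorem neg_Y (F : Frame) (p : Plane) : F.neg.Y p = -F.Y p := by simp [Y, neg]

/-- The vector pointing in the positive direction of abscissas with slope `t`. -/
noncomputable def dir (F : Frame) (t : ℝ) : Plane := !₂[F.sgn * (1 - F.shear * t), F.sgn * t]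

theorem dir_zero (F : Frame) (t : ℝ) : F.dir t 0 = F.sgn * (1 - F.shear * t) := by simp [dir]

theorem dir_one (F : Frame) (t : ℝ) : F.dir t 1 = F.sgn * t := by simp [dir]

theorem X_dir (F : Frame) (t : ℝ) : F.X (F.dir t) = 1 := by
  rw [X, dir_zero, dir_one]
  linear_combination F.sgn_sq

theorem Y_dir (F : Frame) (t : ℝ) : F.Y (F.dir t) = t := by
  rw [Y, dir_one]
  linear_combination t * F.sgn_sq

theorem X_add_smul (F : Frame) (p v : Plane) (s : ℝ) :
    F.X (p + s • v) = F.X p + s * F.X v := by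
  simp [X]; ring

theorem Y_add_smul (F : Frame) (p v : Plane) (s : ℝ) :
    F.Y (p + s • v) = F.Y p + s * F.Y v := by
  simp [Y]; ring

theorem X_sub (F : Frame) (p q : Plane) : F.X (p - q) = F.X p - F.X q := by
  simp [X]; ring

theorem Y_sub (F : Frame) (p q : Plane) : F.Y (p - q) = F.Y p - F.Y q := by
  simp [Y]; ring

theorem cross_eq (F : Frame) (u v : Plane) : cross u v = F.X u * F.Y v - F.Y u * F.X v := by
  simp only [cross, X, Y]
  linear_combination -(u 0 * v 1 - u 1 * v 0) * F.sgn_sq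

theorem ext_XY (F : Frame) {p q : Plane} (hX : F.X p = F.X q) (hY : F.Y p = F.Y q) : p = q := by
  have hs := F.sgn_sq
  have hs0 : F.sgn ≠ 0 := by
    rintro h
    simp [h] at hs
  simp only [X, Y] at hX hY
  have h1 := mul_left_cancel₀ hs0 hY
  have h0 := mul_left_cancel₀ hs0 hX
  rw [h1] at h0
  exact plane_ext (by linarith) h1

theorem dir_ne_zero (F : Frame) (t : ℝ) : F.dir t ≠ 0 := by
  intro h
  have := F.X_dir t
  rw [h] at this
  simp [X] at this

theorem cross_dir (F : Frame) (s t : ℝ) : cross (F.dir s) (F.dir t) = t - s := by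
  rw [cross, dir_zero, dir_one, dir_zero, dir_one]
  linear_combination (t - s) * F.sgn_sq

theorem directionAngle_dir_lt (F : Frame) {s t : ℝ} (hst : s < t)
    (h : (0 < s ∧ 0 < t) ∨ (s < 0 ∧ t < 0)) :
    directionAngle (F.dir s) < directionAngle (F.dir t) := by
  apply directionAngle_lt_of_cross_pos
  · rw [cross_dir]; linarith
  · rw [dir_one, dir_one]
    have hs : F.sgn = 1 ∨ F.sgn = -1 := mul_self_eq_one_iff.1 F.sgn_sq
    rcases hs with hs | hs <;> rw [hs] <;> rcases h with ⟨h1, h2⟩ | ⟨h1, h2⟩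
    · left; constructor <;> linarith
    · right; constructor <;> linarith
    · right; constructor <;> linarith
    · left; constructor <;> linarith

/-- The ordinate, at abscissa `x`, of the line of slope `t` through `p`. -/
def height (F : Frame) (t : Plane → ℝ) (p : Plane) (x : ℝ) : ℝ := F.Y p + t p * (x - F.X p)

/-- The rays from `P` with slopes `t` (in the positive direction of abscissas) have different
slopes and are disjoint. -/
def Fan (F : Frame) (P : Finset Plane) (t : Plane → ℝ) : Prop :=
  ∀ p ∈ P, ∀ q ∈ P, p ≠ q → t p ≠ t q ∧
    (t p < t q → F.height t p (max (F.X p) (F.X q)) < F.height t q (max (F.X p) (F.X q)))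

/-- Two rays can only meet beyond the larger apex abscissa. There the steeper one starts above, and
the gap never shrinks. -/
theorem Fan.isDisjointRaySystem {F : Frame} {P : Finset Plane} {t : Plane → ℝ} (h : F.Fan P t) :
    IsDisjointRaySystem P (fun p => F.dir (t p)) := by
  refine ⟨fun p _ => F.dir_ne_zero _, ?_⟩
  have key : ∀ p ∈ P, ∀ q ∈ P, p ≠ q → t p < t q →
      ∀ x ∈ ray p (F.dir (t p)), x ∉ ray q (F.dir (t q)) := by
    rintro p hp q hq hpq hlt x ⟨s, hs, hx⟩ ⟨s', hs', hx'⟩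
    have h1 := (h p hp q hq hpq).2 hlt
    have hX : F.X x = F.X p + s := by rw [hx, X_add_smul, X_dir, mul_one]
    have hY : F.Y x = F.Y p + s * t p := by rw [hx, Y_add_smul, Y_dir]
    have hX' : F.X x = F.X q + s' := by rw [hx', X_add_smul, X_dir, mul_one]
    have hY' : F.Y x = F.Y q + s' * t q := by rw [hx', Y_add_smul, Y_dir]
    have hmax : max (F.X p) (F.X q) ≤ F.X x := max_le (by linarith) (by linarith)
    simp only [height] at h1
    have hs1 : s = F.X x - F.X p := by linarith
    have hs2 : s' = F.X x - F.X q := by linarith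
    subst hs1 hs2
    have := mul_le_mul_of_nonneg_left hmax (sub_nonneg.2 hlt.le)
    linarith
  intro p hp q hq hpq
  rw [Set.disjoint_left]
  rcases lt_or_gt_of_ne (h p hp q hq hpq).1 with hlt | hlt
  · exact key p hp q hq hpq hlt
  · intro x hx hx'
    exact key q hq p hp hpq.symm hlt x hx' hx

/-- A point on no line of a fan admits a range of slopes at which it can be added to the fan. -/
theorem exists_cut (F : Frame) (p : Plane) (t : Plane → ℝ) (P : Finset Plane) :
    F.Fan P t → (∀ q ∈ P, F.height t q (F.X p) ≠ F.Y p) →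
    ∃ L : Finset Plane, L ⊆ P ∧ (∀ q ∈ L, ∀ u ∈ P, u ∉ L → t q < t u) ∧
      ∀ s : ℝ, (∀ q ∈ L, t q < s) → (∀ u ∈ P, u ∉ L → s < t u) → ∀ q ∈ P,
        (q ∈ L → F.height t q (max (F.X p) (F.X q)) <
          F.Y p + s * (max (F.X p) (F.X q) - F.X p)) ∧
        (q ∉ L → F.Y p + s * (max (F.X p) (F.X q) - F.X p) <
          F.height t q (max (F.X p) (F.X q))) := by
  classical
  -- The point `e` removed last to first is the rightmost one: at its abscissa all other rays have
  -- begun, so their slopes tell whether they pass above or below `e`.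
  refine Finset.induction_on_max_value F.X P ?_ ?_
  · intro _ _
    exact ⟨∅, by simp⟩
  intro e P heP hmax ih hfan hne
  obtain ⟨L, hLP, hLt, hL⟩ := ih
    (fun a ha b hb => hfan a (Finset.mem_insert_of_mem ha) b (Finset.mem_insert_of_mem hb))
    (fun q hq => hne q (Finset.mem_insert_of_mem hq))
  have hne' : ∀ q ∈ P, q ≠ e := fun q hq h => heP (h ▸ hq)
  have hslope : ∀ q ∈ P, t q ≠ t e := fun q hq =>
    (hfan q (Finset.mem_insert_of_mem hq) e (Finset.mem_insert_self _ _) (hne' q hq)).1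
  have hbelow : ∀ q ∈ P, t q < t e → F.height t q (F.X e) < F.Y e := by
    intro q hq hlt
    have := (hfan q (Finset.mem_insert_of_mem hq) e (Finset.mem_insert_self _ _) (hne' q hq)).2 hlt
    rw [max_eq_right (hmax q hq)] at this
    simpa [height] using this
  have habove : ∀ q ∈ P, t e < t q → F.Y e < F.height t q (F.X e) := by
    intro q hq hlt
    have := (hfan e (Finset.mem_insert_self _ _) q (Finset.mem_insert_of_mem hq)
      (hne' q hq).symm).2 hlt
    rw [max_eq_left (hmax q hq)] at this
    simpa [height] using this
  -- adding `e` to the lower part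
  have addLow : (∀ u ∈ P, u ∉ L → t e < t u) →
      (∀ s : ℝ, (∀ q ∈ L, t q < s) → t e < s → (∀ u ∈ P, u ∉ L → s < t u) →
        F.height t e (max (F.X p) (F.X e)) < F.Y p + s * (max (F.X p) (F.X e) - F.X p)) →
      ∃ L : Finset Plane, L ⊆ insert e P ∧ (∀ q ∈ L, ∀ u ∈ insert e P, u ∉ L → t q < t u) ∧
      ∀ s : ℝ, (∀ q ∈ L, t q < s) → (∀ u ∈ insert e P, u ∉ L → s < t u) → ∀ q ∈ insert e P,
        (q ∈ L → F.height t q (max (F.X p) (F.X q)) <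
          F.Y p + s * (max (F.X p) (F.X q) - F.X p)) ∧
        (q ∉ L → F.Y p + s * (max (F.X p) (F.X q) - F.X p) <
          F.height t q (max (F.X p) (F.X q))) := by
    intro h1 h2
    refine ⟨insert e L, Finset.insert_subset_insert _ hLP, ?_, ?_⟩
    · intro q hq u hu huL
      rw [Finset.mem_insert, not_or] at huL
      have huP := Finset.mem_of_mem_insert_of_ne hu huL.1
      rcases Finset.mem_insert.1 hq with rfl | hq
      · exact h1 u huP huL.2
      · exact hLt q hq u huP huL.2
    · intro s hs1 hs2 q hq
      have hsL : ∀ q ∈ L, t q < s := fun q hq => hs1 q (Finset.mem_insert_of_mem hq)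
      have hse : t e < s := hs1 e (Finset.mem_insert_self _ _)
      have hsU : ∀ u ∈ P, u ∉ L → s < t u := fun u hu huL =>
        hs2 u (Finset.mem_insert_of_mem hu) (by
          rw [Finset.mem_insert, not_or]; exact ⟨hne' u hu, huL⟩)
      rcases Finset.mem_insert.1 hq with rfl | hq
      · exact ⟨fun _ => h2 s hsL hse hsU, fun h => absurd (Finset.mem_insert_self _ _) h⟩
      · have := hL s hsL hsU q hq
        rw [Finset.mem_insert, not_or]
        refine ⟨fun h => this.1 (h.resolve_left (hne' q hq)), fun h => this.2 h.2⟩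
  -- leaving `e` in the upper part
  have addUp : (∀ q ∈ L, t q < t e) →
      (∀ s : ℝ, (∀ q ∈ L, t q < s) → s < t e → (∀ u ∈ P, u ∉ L → s < t u) →
        F.Y p + s * (max (F.X p) (F.X e) - F.X p) < F.height t e (max (F.X p) (F.X e))) →
      ∃ L : Finset Plane, L ⊆ insert e P ∧ (∀ q ∈ L, ∀ u ∈ insert e P, u ∉ L → t q < t u) ∧
      ∀ s : ℝ, (∀ q ∈ L, t q < s) → (∀ u ∈ insert e P, u ∉ L → s < t u) → ∀ q ∈ insert e P,
        (q ∈ L → F.height t q (max (F.X p) (F.X q)) <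
          F.Y p + s * (max (F.X p) (F.X q) - F.X p)) ∧
        (q ∉ L → F.Y p + s * (max (F.X p) (F.X q) - F.X p) <
          F.height t q (max (F.X p) (F.X q))) := by
    intro h1 h2
    have heL : e ∉ L := fun h => heP (hLP h)
    refine ⟨L, hLP.trans (Finset.subset_insert _ _), ?_, ?_⟩
    · intro q hq u hu huL
      rcases Finset.mem_insert.1 hu with rfl | hu
      · exact h1 q hq
      · exact hLt q hq u hu huL
    · intro s hs1 hs2 q hq
      have hsU : ∀ u ∈ P, u ∉ L → s < t u := fun u hu huL =>
        hs2 u (Finset.mem_insert_of_mem hu) huL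
      rcases Finset.mem_insert.1 hq with rfl | hq
      · exact ⟨fun h => absurd h heL,
          fun _ => h2 s hs1 (hs2 q (Finset.mem_insert_self _ _) heL) hsU⟩
      · exact hL s hs1 hsU q hq
  have hxp : F.X p ≤ max (F.X p) (F.X e) := le_max_left _ _
  have hxe : F.X e ≤ max (F.X p) (F.X e) := le_max_right _ _
  -- A ray of the lower part steeper than `e` passes above `e`, while the new ray runs above that
  -- ray; hence `e` joins the lower part. The next case is its mirror image.
  by_cases hA : ∃ i ∈ L, t e < t i
  · obtain ⟨i, hiL, hi⟩ := hA
    refine addLow (fun u hu huL => hi.trans (hLt i hiL u hu huL)) ?_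
    intro s hs1 _ hs2
    have h1 := (hL s hs1 hs2 i (hLP hiL)).1 hiL
    have h2 := habove i (hLP hiL) hi
    have h3 := hs1 i hiL
    have h4 : max (F.X p) (F.X i) ≤ max (F.X p) (F.X e) :=
      max_le_max le_rfl (hmax i (hLP hiL))
    simp only [height] at *
    nlinarith
  by_cases hB : ∃ i ∈ P, i ∉ L ∧ t i < t e
  · obtain ⟨i, hiP, hiL, hi⟩ := hB
    refine addUp (fun q hq => (hLt q hq i hiP hiL).trans hi) ?_
    intro s hs1 _ hs2
    have h1 := (hL s hs1 hs2 i hiP).2 hiL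
    have h2 := hbelow i hiP hi
    have h3 := hs2 i hiP hiL
    have h4 : max (F.X p) (F.X i) ≤ max (F.X p) (F.X e) :=
      max_le_max le_rfl (hmax i hiP)
    simp only [height] at *
    nlinarith
  push Not at hA hB
  have hA' : ∀ q ∈ L, t q < t e := fun q hq => lt_of_le_of_ne (hA q hq) (hslope q (hLP hq))
  have hB' : ∀ u ∈ P, u ∉ L → t e < t u := fun u hu huL =>
    lt_of_le_of_ne (hB u hu huL) (hslope u hu).symm
  -- Now the slope of `e` lies in the gap. The side is dictated by the position of `p` relative to
  -- the full line of `e`, and the comparison of slopes preserves it to the right of `p`.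
  rcases lt_or_gt_of_ne (hne e (Finset.mem_insert_self _ _)) with h | h
  · refine addLow hB' ?_
    intro s _ hs _
    simp only [height] at *
    nlinarith
  · refine addUp hA' ?_
    intro s _ hs _
    simp only [height] at *
    nlinarith

end Frame


/-! ### Extending fans and making the ends of segments alternate -/

namespace Frame

theorem exists_between_avoiding {ι : Type*} (A B : Finset ι) (t : ι → ℝ) (bad : Finset ℝ)
    (h : ∀ a ∈ A, ∀ b ∈ B, t a < t b) :
    ∃ s : ℝ, (∀ a ∈ A, t a < s) ∧ (∀ b ∈ B, s < t b) ∧ s ∉ bad := by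
  classical
  set U : Set ℝ := (⋂ a ∈ A, Set.Ioi (t a)) ∩ ⋂ b ∈ B, Set.Iio (t b) with hU
  have hopen : IsOpen U :=
    (isOpen_biInter_finset fun _ _ => isOpen_Ioi).inter
      (isOpen_biInter_finset fun _ _ => isOpen_Iio)
  obtain ⟨m, hm1, hm2⟩ := Order.exists_between_finsets (A.image t) (B.image t) (by
    simpa using h)
  have hm : m ∈ U := by
    simp only [hU, Set.mem_inter_iff, Set.mem_iInter, Set.mem_Ioi, Set.mem_Iio]
    exact ⟨fun a ha => hm1 _ (Finset.mem_image_of_mem _ ha),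
      fun b hb => hm2 _ (Finset.mem_image_of_mem _ hb)⟩
  have hinf : U.Infinite := infinite_of_mem_nhds m (hopen.mem_nhds hm)
  obtain ⟨s, hsU, hs⟩ := hinf.exists_notMem_finset bad
  simp only [hU, Set.mem_inter_iff, Set.mem_iInter, Set.mem_Ioi, Set.mem_Iio] at hsU
  exact ⟨s, hsU.1, hsU.2, hs⟩

/-- A point on no line of a fan can be added to it, with a slope avoiding zero and the lines
through other points. -/
theorem Fan.exists_insert {F : Frame} {P : Finset Plane} {t : Plane → ℝ} (hfan : F.Fan P t)
    {p : Plane} (hp : p ∉ P) (hne : ∀ q ∈ P, F.height t q (F.X p) ≠ F.Y p) (S : Finset Plane) :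
    ∃ t' : Plane → ℝ, (∀ q ∈ P, t' q = t q) ∧ (∀ S' : Finset Plane,
      (∀ q, q ∈ S' ↔ q = p ∨ q ∈ P) → F.Fan S' t') ∧ t' p ≠ 0 ∧
      ∀ u ∈ S, u ≠ p → F.height t' p (F.X u) ≠ F.Y u := by
  classical
  obtain ⟨L, hLP, hLt, hL⟩ := F.exists_cut p t P hfan hne
  -- The excluded slopes are zero (so that directions stay off the horizontal), those already used,
  -- and those of lines towards other points of `S`, which must remain insertable later.
  obtain ⟨s, hs1, hs2, hs3⟩ := exists_between_avoiding L (P \ L) t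
    (insert 0 (P.image t ∪ S.image fun u => (F.Y u - F.Y p) / (F.X u - F.X p))) (by
      intro a ha b hb
      rw [Finset.mem_sdiff] at hb
      exact hLt a ha b hb.1 hb.2)
  have hs2' : ∀ u ∈ P, u ∉ L → s < t u := fun u hu huL => hs2 u (Finset.mem_sdiff.2 ⟨hu, huL⟩)
  simp only [Finset.mem_insert, Finset.mem_union, Finset.mem_image, not_or, not_exists,
    not_and] at hs3
  obtain ⟨hs0, hst, hsS⟩ := hs3
  have hpq : ∀ q ∈ P, q ≠ p := fun q hq h => hp (h ▸ hq)
  refine ⟨Function.update t p s, fun q hq => Function.update_of_ne (hpq q hq) _ _, ?_, ?_, ?_⟩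
  · have hpar : ∀ q ∈ P, (t q < s → F.height t q (max (F.X p) (F.X q)) <
          F.Y p + s * (max (F.X p) (F.X q) - F.X p)) ∧
        (s < t q → F.Y p + s * (max (F.X p) (F.X q) - F.X p) <
          F.height t q (max (F.X p) (F.X q))) := by
      intro q hq
      refine ⟨fun h => (hL s hs1 hs2' q hq).1 ?_, fun h => (hL s hs1 hs2' q hq).2 ?_⟩
      · by_contra hqL
        exact lt_asymm h (hs2' q hq hqL)
      · intro hqL
        exact lt_asymm h (hs1 q hqL)
    intro S' hS' a ha b hb hab
    rcases (hS' a).1 ha with rfl | ha <;> rcases (hS' b).1 hb with rfl | hb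
    · exact absurd rfl hab
    · simp only [height, Function.update_self, Function.update_of_ne (hpq b hb)]
      exact ⟨fun h => hst b hb h.symm, (hpar b hb).2⟩
    · simp only [height, Function.update_self, Function.update_of_ne (hpq a ha)]
      refine ⟨hst a ha, fun h => ?_⟩
      have := (hpar a ha).1 h
      rw [max_comm]
      exact this
    · simp only [height, Function.update_of_ne (hpq b hb), Function.update_of_ne (hpq a ha)]
      exact hfan a ha b hb hab
  · simpa using hs0
  · intro u hu hup heq
    simp only [height, Function.update_self] at heq
    have hX : F.X u - F.X p ≠ 0 := by
      intro h
      rw [h, mul_zero, add_zero] at heq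
      exact hup (F.ext_XY (by linarith) heq.symm)
    refine hsS u hu ?_
    field_simp
    linarith

/-- A fan on a subset of `S`, in general position to the rest of `S`, extends to `S`. -/
theorem Fan.exists_extend {F : Frame} {P S : Finset Plane} {t : Plane → ℝ} (hfan : F.Fan P t)
    (hPS : P ⊆ S) (h0 : ∀ q ∈ P, t q ≠ 0)
    (hgen : ∀ q ∈ P, ∀ u ∈ S, u ∉ P → F.height t q (F.X u) ≠ F.Y u) :
    ∃ t' : Plane → ℝ, (∀ q ∈ P, t' q = t q) ∧ F.Fan S t' ∧ ∀ q ∈ S, t' q ≠ 0 := by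
  classical
  have key : ∀ Q : Finset Plane, Q ⊆ S \ P → ∃ t' : Plane → ℝ, (∀ q ∈ P, t' q = t q) ∧
      F.Fan (P ∪ Q) t' ∧ (∀ q ∈ P ∪ Q, t' q ≠ 0) ∧
      ∀ q ∈ P ∪ Q, ∀ u ∈ S, u ∉ P ∪ Q → F.height t' q (F.X u) ≠ F.Y u := by
    intro Q
    induction Q using Finset.induction_on with
    | empty =>
      intro _
      exact ⟨t, fun _ _ => rfl, by simpa using hfan, by simpa using h0, by simpa using hgen⟩
    | insert p Q hpQ ih =>
      intro hQ
      obtain ⟨t₁, h1, h2, h3, h4⟩ := ih ((Finset.subset_insert _ _).trans hQ)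
      have hp := Finset.mem_sdiff.1 (hQ (Finset.mem_insert_self _ _))
      have hpPQ : p ∉ P ∪ Q := by simp [hp.2, hpQ]
      obtain ⟨t₂, g1, g2, g3, g4⟩ := h2.exists_insert hpPQ (fun q hq => h4 q hq p hp.1 hpPQ) S
      have hmem : ∀ q, q ∈ P ∪ insert p Q ↔ q = p ∨ q ∈ P ∪ Q := by
        intro q; simp only [Finset.mem_union, Finset.mem_insert]; tauto
      refine ⟨t₂, fun q hq => ?_, g2 _ hmem, fun q hq => ?_, fun q hq u hu hun => ?_⟩
      · rw [g1 q (Finset.mem_union_left _ hq), h1 q hq]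
      · rcases (hmem q).1 hq with rfl | hq
        · exact g3
        · rw [g1 q hq]; exact h3 q hq
      · rw [hmem, not_or] at hun
        rcases (hmem q).1 hq with rfl | hq
        · exact g4 u hu hun.1
        · simp only [height, g1 q hq]
          exact h4 q hq u hu hun.2
  obtain ⟨t', h1, h2, h3, -⟩ := key (S \ P) subset_rfl
  rw [Finset.union_sdiff_of_subset hPS] at h2 h3
  exact ⟨t', h1, h2, h3⟩

theorem eventually_sub_mul_ne_zero {A B : ℝ} (h : A ≠ 0 ∨ B ≠ 0) :
    ∀ᶠ δ : ℝ in 𝓝[>] 0, A - δ * B ≠ 0 := by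
  by_cases hA : A = 0
  · have hB := h.resolve_left (not_not.2 hA)
    filter_upwards [self_mem_nhdsWithin] with δ hδ
    rw [hA, zero_sub, neg_ne_zero]
    exact mul_ne_zero (ne_of_gt hδ) hB
  · have hc : Continuous fun δ : ℝ => A - δ * B := by fun_prop
    refine eventually_nhdsWithin_of_eventually_nhds ?_
    exact hc.continuousAt.eventually_ne (by simpa using hA)

theorem exists_mem_segment (F : Frame) {p q : Plane} {τ x : ℝ} (hlt : F.X p < F.X q)
    (hτ : F.Y q = F.Y p + τ * (F.X q - F.X p)) (h1 : F.X p ≤ x) (h2 : x ≤ F.X q) :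
    ∃ z ∈ segment ℝ p q, F.X z = x ∧ F.Y z = F.Y p + τ * (x - F.X p) := by
  have hpos : 0 < F.X q - F.X p := by linarith
  set s := (x - F.X p) / (F.X q - F.X p) with hs
  have hsx : s * (F.X q - F.X p) = x - F.X p := by
    rw [hs]; field_simp
  refine ⟨p + s • (q - p), ?_, ?_, ?_⟩
  · rw [segment_eq_image']
    refine ⟨s, ⟨?_, ?_⟩, rfl⟩
    · rw [hs]; apply div_nonneg <;> linarith
    · rw [hs, div_le_one hpos]; linarith
  · rw [X_add_smul, X_sub, hsx]; ring
  · rw [Y_add_smul, Y_sub, hτ]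
    linear_combination τ * hsx

/-- Disjoint segments across the vertical line at `c`, whose heights on that line and slopes
increase together, give rise to a fan in which their left and right ends alternate. -/
theorem exists_fan_alternating (F : Frame) (S : Finset Plane) (c : ℝ) {k : ℕ}
    (p q : Fin k → Plane) (τ : Fin k → ℝ) (hp : ∀ i, p i ∈ S) (hq : ∀ i, q i ∈ S)
    (hpq : ∀ i j, q i ≠ p j) (hpc : ∀ i, F.X (p i) ≤ c) (hqc : ∀ i, c ≤ F.X (q i))
    (hlt : ∀ i, F.X (p i) < F.X (q i))
    (hτ : ∀ i, F.Y (q i) = F.Y (p i) + τ i * (F.X (q i) - F.X (p i))) (hmono : StrictMono τ)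
    (hheight : StrictMono fun i => F.Y (p i) + τ i * (c - F.X (p i)))
    (hdisj : ∀ i j, i ≠ j → Disjoint (segment ℝ (p i) (q i)) (segment ℝ (p j) (q j))) :
    ∃ t : Plane → ℝ, F.Fan S t ∧ (∀ u ∈ S, t u ≠ 0) ∧ (∀ i, t (p i) < t (q i)) ∧
      ∀ i j, i < j → t (q i) < t (p j) := by
  classical
  have hinj : Function.Injective p := by
    intro i j hij
    by_contra h
    exact Set.disjoint_left.1 (hdisj i j h) (left_mem_segment ℝ _ _)
      (hij ▸ left_mem_segment ℝ _ _)
  have hmem : ∀ i x, F.X (p i) ≤ x → x ≤ F.X (q i) →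
      ∃ z ∈ segment ℝ (p i) (q i), F.X z = x ∧ F.Y z = F.Y (p i) + τ i * (x - F.X (p i)) :=
    fun i x h1 h2 => F.exists_mem_segment (hlt i) (hτ i) h1 h2
  -- Otherwise the two lines, ordered one way at `c` and the other way at the later apex, would meet
  -- between these abscissas, where both segments are present.
  have hstart : ∀ i j, i < j →
      F.Y (p i) + τ i * (max (F.X (p i)) (F.X (p j)) - F.X (p i)) <
      F.Y (p j) + τ j * (max (F.X (p i)) (F.X (p j)) - F.X (p j)) := by
    intro i j hij
    by_contra hcon
    push Not at hcon
    have h1 : F.Y (p i) + τ i * (c - F.X (p i)) < F.Y (p j) + τ j * (c - F.X (p j)) :=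
      hheight hij
    have h2 : 0 < τ j - τ i := sub_pos.2 (hmono hij)
    set M := max (F.X (p i)) (F.X (p j)) with hM
    set E := F.Y (p j) + τ j * (c - F.X (p j)) - (F.Y (p i) + τ i * (c - F.X (p i))) with hE
    have hEx : E / (τ j - τ i) * (τ j - τ i) = E := by field_simp
    set x := c - E / (τ j - τ i) with hx
    have hxM : M ≤ x := by
      rw [hx, le_sub_comm, div_le_iff₀ h2]
      linarith
    have hxc : x ≤ c := by
      rw [hx]
      have : 0 < E / (τ j - τ i) := div_pos (by linarith) h2
      linarith
    obtain ⟨z, hz, hzX, hzY⟩ := hmem i x ((le_max_left _ _).trans hxM) (hxc.trans (hqc i))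
    obtain ⟨z', hz', hzX', hzY'⟩ := hmem j x ((le_max_right _ _).trans hxM) (hxc.trans (hqc j))
    have : z = z' := by
      apply F.ext_XY (hzX.trans hzX'.symm)
      rw [hzY, hzY', hx]
      linear_combination hE + hEx
    subst this
    exact Set.disjoint_left.1 (hdisj i j hij.ne) hz hz'
  have habove : ∀ i j, i < j →
      F.Y (q i) < F.Y (p j) + τ j * (F.X (q i) - F.X (p j)) := by
    intro i j hij
    have h1 : F.Y (p i) + τ i * (c - F.X (p i)) < F.Y (p j) + τ j * (c - F.X (p j)) :=
      hheight hij
    have h2 := hmono hij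
    have h3 := hqc i
    rw [hτ i]
    nlinarith
  set P : Finset Plane := Finset.univ.image p with hP
  have hPmem : ∀ i, p i ∈ P := fun i => Finset.mem_image_of_mem _ (Finset.mem_univ _)
  -- Every requirement below holds for all sufficiently small tilts `δ > 0`. The tilt puts `q i`
  -- strictly above the line of `p i`, and `u ≠ p i` lies on that line for at most one `δ`.
  have ev1 : ∀ᶠ δ : ℝ in 𝓝[>] 0, ∀ i j, i < j →
      F.Y (p i) + (τ i - δ) * (max (F.X (p i)) (F.X (p j)) - F.X (p i)) <
      F.Y (p j) + (τ j - δ) * (max (F.X (p i)) (F.X (p j)) - F.X (p j)) := by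
    refine eventually_all.2 fun i => eventually_all.2 fun j => eventually_all.2 fun hij => ?_
    refine eventually_nhdsWithin_of_eventually_nhds ?_
    refine ContinuousAt.eventually_lt (by fun_prop) (by fun_prop) ?_
    simpa using hstart i j hij
  have ev2 : ∀ᶠ δ : ℝ in 𝓝[>] 0, ∀ i j, i < j →
      F.Y (q i) < F.Y (p j) + (τ j - δ) * (F.X (q i) - F.X (p j)) := by
    refine eventually_all.2 fun i => eventually_all.2 fun j => eventually_all.2 fun hij => ?_
    refine eventually_nhdsWithin_of_eventually_nhds ?_
    refine ContinuousAt.eventually_lt (by fun_prop) (by fun_prop) ?_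
    simpa using habove i j hij
  have ev3 : ∀ᶠ δ : ℝ in 𝓝[>] 0, ∀ i, ∀ u ∈ S, u ∉ P →
      F.Y (p i) + (τ i - δ) * (F.X u - F.X (p i)) ≠ F.Y u := by
    refine eventually_all.2 fun i => (S.eventually_all).2 fun u _ => eventually_all.2 fun huP => ?_
    have : F.Y (p i) + τ i * (F.X u - F.X (p i)) - F.Y u ≠ 0 ∨ F.X u - F.X (p i) ≠ 0 := by
      by_contra hcon
      push Not at hcon
      obtain ⟨h1, h2⟩ := hcon
      rw [h2, mul_zero, add_zero] at h1
      exact huP (F.ext_XY (sub_eq_zero.1 h2) (sub_eq_zero.1 h1).symm ▸ hPmem i)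
    filter_upwards [eventually_sub_mul_ne_zero this] with δ hδ h
    apply hδ
    linear_combination h
  have ev4 : ∀ᶠ δ : ℝ in 𝓝[>] 0, ∀ i, τ i - δ ≠ 0 := by
    refine eventually_all.2 fun i => ?_
    simpa using eventually_sub_mul_ne_zero (A := τ i) (B := 1) (Or.inr one_ne_zero)
  have ev5 : ∀ᶠ δ : ℝ in 𝓝[>] 0, 0 < δ := self_mem_nhdsWithin
  obtain ⟨δ, h1, h2, h3, h4, h5⟩ := (ev1.and (ev2.and (ev3.and (ev4.and ev5)))).exists
  set t₀ : Plane → ℝ := Function.extend p (fun i => τ i - δ) 0 with ht₀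
  have ht : ∀ i, t₀ (p i) = τ i - δ := fun i => hinj.extend_apply _ _ i
  have hfan₀ : F.Fan P t₀ := by
    intro a ha b hb hab
    obtain ⟨i, -, rfl⟩ := Finset.mem_image.1 ha
    obtain ⟨j, -, rfl⟩ := Finset.mem_image.1 hb
    have hij : i ≠ j := fun h => hab (by rw [h])
    simp only [height, ht]
    refine ⟨fun h => hij (hmono.injective (by linarith)), fun h => h1 i j ?_⟩
    exact hmono.lt_iff_lt.1 (by linarith)
  obtain ⟨t, ht1, ht2, ht3⟩ := hfan₀.exists_extend (S := S)
    (by rw [hP]; exact Finset.image_subset_iff.2 fun i _ => hp i)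
    (by
      intro a ha
      obtain ⟨i, -, rfl⟩ := Finset.mem_image.1 ha
      rw [ht]; exact h4 i)
    (by
      intro a ha u hu huP
      obtain ⟨i, -, rfl⟩ := Finset.mem_image.1 ha
      simp only [height, ht]; exact h3 i u hu huP)
  have htp : ∀ i, t (p i) = τ i - δ := fun i => by rw [ht1 _ (hPmem i), ht]
  -- In a fan the ray of smaller slope is lower at the later apex. Here `q i` is above the ray of `p
  -- i` and below the ray of each later `p j`, so its slope lies between theirs.
  refine ⟨t, ht2, ht3, fun i => ?_, fun i j hij => ?_⟩
  · by_contra hcon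
    push Not at hcon
    have hf := ht2 (q i) (hq i) (p i) (hp i) (hpq i i)
    have h6 := hf.2 (lt_of_le_of_ne hcon hf.1)
    rw [max_eq_left (hlt i).le] at h6
    simp only [height, htp, sub_self, mul_zero, add_zero] at h6
    rw [hτ i] at h6
    nlinarith [hlt i]
  · by_contra hcon
    push Not at hcon
    have hf := ht2 (p j) (hp j) (q i) (hq i) (hpq i j).symm
    have h6 := hf.2 (lt_of_le_of_ne hcon hf.1)
    rw [max_eq_right ((hpc j).trans (hqc i))] at h6
    simp only [height, htp, sub_self, mul_zero, add_zero] at h6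
    exact lt_asymm h6 (h2 i j hij)

end Frame


/-! ### Collinearity and parallelism through cross products -/

theorem cross_eq_zero_iff {u v : Plane} (hu : u ≠ 0) : cross u v = 0 ↔ ∃ r : ℝ, v = r • u := by
  constructor
  · intro h
    rw [cross] at h
    by_cases h0 : u 0 = 0
    · have h1 : u 1 ≠ 0 := fun h1 => hu (plane_ext (by simpa using h0) (by simpa using h1))
      refine ⟨v 1 / u 1, plane_ext ?_ ?_⟩
      · rw [h0, zero_mul, zero_sub, neg_eq_zero] at h
        simp [h0, (mul_eq_zero.1 h).resolve_left h1]
      · simp [h1]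
    · refine ⟨v 0 / u 0, plane_ext ?_ ?_⟩
      · simp [h0]
      · simp only [PiLp.smul_apply, smul_eq_mul]
        field_simp
        linarith
  · rintro ⟨r, rfl⟩
    simp [cross]; ring

theorem parallel_iff_cross {p q u w : Plane} (hpq : p ≠ q) (huw : u ≠ w) :
    AffineSubspace.Parallel (affineSpan ℝ ({p, q} : Set Plane))
      (affineSpan ℝ ({u, w} : Set Plane)) ↔ cross (q - p) (w - u) = 0 := by
  rw [AffineSubspace.affineSpan_pair_parallel_iff_vectorSpan_eq, vectorSpan_pair_rev,
    vectorSpan_pair_rev, cross_eq_zero_iff (sub_ne_zero.2 hpq.symm), vsub_eq_sub, vsub_eq_sub]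
  constructor
  · intro h
    have : w - u ∈ Submodule.span ℝ {q - p} := by
      rw [h]; exact Submodule.mem_span_singleton_self _
    obtain ⟨r, hr⟩ := Submodule.mem_span_singleton.1 this
    exact ⟨r, hr.symm⟩
  · rintro ⟨r, hr⟩
    have hr0 : r ≠ 0 := by
      rintro rfl
      rw [zero_smul] at hr
      exact huw (sub_eq_zero.1 hr).symm
    rw [hr, Submodule.span_singleton_smul_eq (IsUnit.mk0 r hr0)]

theorem collinear_iff_cross {p q u : Plane} (hpq : p ≠ q) :
    Collinear ℝ ({p, q, u} : Set Plane) ↔ cross (q - p) (u - p) = 0 := by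
  rw [cross_eq_zero_iff (sub_ne_zero.2 hpq.symm),
    collinear_iff_of_mem (p₀ := p) (by simp)]
  constructor
  · rintro ⟨v, hv⟩
    obtain ⟨r, hr⟩ := hv q (by simp)
    obtain ⟨s, hs⟩ := hv u (by simp)
    simp only [vadd_eq_add] at hr hs
    have hr0 : r ≠ 0 := by
      rintro rfl
      exact hpq (by simp [hr])
    refine ⟨s / r, ?_⟩
    rw [hr, hs]
    simp only [add_sub_cancel_right, smul_smul]
    congr 1
    field_simp
  · rintro ⟨r, hr⟩
    refine ⟨q - p, ?_⟩
    rintro x (rfl | rfl | rfl)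
    · exact ⟨0, by simp⟩
    · exact ⟨1, by simp⟩
    · exact ⟨r, by simp [← hr]⟩

/-! ### Monotone subsequences -/

/-- Peel off the elements minimal for the order given by `f` and `g` together: they form a
decreasing sequence. If there are at most `b` of them, an increasing sequence among the rest extends
downwards, because its first element is not minimal. -/
theorem exists_monotone_or_antitone_subset {ι : Type*} (f g : ι → ℝ) (b : ℕ) (a : ℕ) :
    ∀ T : Finset ι, Set.InjOn f T → Set.InjOn g T → a * b < T.card →
    (∃ U ⊆ T, U.card = a + 1 ∧ ∀ x ∈ U, ∀ y ∈ U, f x < f y → g x < g y) ∨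
    (∃ U ⊆ T, U.card = b + 1 ∧ ∀ x ∈ U, ∀ y ∈ U, f x < f y → g y < g x) := by
  classical
  induction a with
  | zero =>
    intro T _ _ hT
    rw [zero_mul, Finset.card_pos] at hT
    obtain ⟨x, hx⟩ := hT
    refine Or.inl ⟨{x}, by simpa using hx, by simp, ?_⟩
    intro y hy z hz h
    rw [Finset.mem_singleton] at hy hz
    subst hy hz
    exact absurd h (lt_irrefl _)
  | succ a ih =>
    intro T hf hg hT
    set M := T.filter fun x => ∀ y ∈ T, ¬(f y < f x ∧ g y < g x) with hM
    by_cases hMc : b + 1 ≤ M.card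
    · obtain ⟨U, hUM, hU⟩ := Finset.exists_subset_card_eq hMc
      refine Or.inr ⟨U, hUM.trans (Finset.filter_subset _ _), hU, ?_⟩
      intro x hx y hy hxy
      have hx' := Finset.mem_filter.1 (hUM hx)
      have hy' := Finset.mem_filter.1 (hUM hy)
      have h1 : g y ≤ g x := by
        by_contra h
        exact hy'.2 x hx'.1 ⟨hxy, not_le.1 h⟩
      refine lt_of_le_of_ne h1 fun h => ?_
      rw [hg hy'.1 hx'.1 h] at hxy
      exact lt_irrefl _ hxy
    · have hcard : a * b < (T \ M).card := by
        have := Finset.card_sdiff_add_card_eq_card (s := M) (t := T) (Finset.filter_subset _ _)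
        rw [add_mul, one_mul] at hT
        omega
      rcases ih (T \ M) (hf.mono (by simp)) (hg.mono (by simp)) hcard with
        ⟨U, hUT, hU, hmono⟩ | ⟨U, hUT, hU, hanti⟩
      · have hUne : U.Nonempty := by rw [← Finset.card_pos]; omega
        obtain ⟨x, hxU, hx⟩ := Finset.exists_min_image U f hUne
        have hxT := Finset.mem_sdiff.1 (hUT hxU)
        have : ∃ y ∈ T, f y < f x ∧ g y < g x := by
          by_contra hcon
          push Not at hcon
          refine hxT.2 (Finset.mem_filter.2 ⟨hxT.1, fun y hy h => ?_⟩)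
          exact absurd h.2 (not_lt.2 (hcon y hy h.1))
        obtain ⟨y, hyT, hfy, hgy⟩ := this
        have hyU : ∀ z ∈ U, f y < f z := fun z hz => hfy.trans_le (hx z hz)
        have hgU : ∀ z ∈ U, g y < g z := fun z hz => by
          rcases (hx z hz).lt_or_eq with h | h
          · exact hgy.trans (hmono x hxU z hz h)
          · rwa [← hf hxT.1 (Finset.mem_sdiff.1 (hUT hz)).1 h]
        have hyn : y ∉ U := fun h => lt_irrefl _ (hyU y h)
        refine Or.inl ⟨insert y U, ?_, by rw [Finset.card_insert_of_notMem hyn, hU], ?_⟩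
        · exact Finset.insert_subset hyT (hUT.trans Finset.sdiff_subset)
        · intro z hz w hw hzw
          rcases Finset.mem_insert.1 hz with h1 | h1 <;> rcases Finset.mem_insert.1 hw with h2 | h2
          · rw [h1, h2] at hzw
            exact absurd hzw (lt_irrefl _)
          · rw [h1]
            exact hgU w h2
          · rw [h2] at hzw
            exact absurd hzw (lt_asymm (hyU z h1))
          · exact hmono z h1 w h2 hzw
      · exact Or.inr ⟨U, hUT.trans Finset.sdiff_subset, hU, hanti⟩

theorem exists_strictMono_enumeration {ι : Type*} (f : ι → ℝ) (U : Finset ι)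
    (hf : Set.InjOn f U) {k : ℕ} (hk : U.card = k) :
    ∃ e : Fin k → ι, (∀ i, e i ∈ U) ∧ StrictMono (f ∘ e) := by
  classical
  have hc : (U.image f).card = k := by rw [Finset.card_image_of_injOn hf, hk]
  have hex : ∀ i : Fin k, ∃ x ∈ U, f x = (U.image f).orderEmbOfFin hc i := fun i =>
    Finset.mem_image.1 (Finset.orderEmbOfFin_mem _ hc i)
  choose e he he' using hex
  refine ⟨e, he, fun i j hij => ?_⟩
  simp only [Function.comp, he']
  exact ((U.image f).orderEmbOfFin hc).strictMono hij

/-- A long sequence contains a long monotone subsequence (Erdős–Szekeres). -/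
theorem exists_monotone_or_antitone_enumeration {ι : Type*} (f g : ι → ℝ) (T : Finset ι)
    (hf : Set.InjOn f T) (hg : Set.InjOn g T) (k : ℕ) (hk : k * k ≤ T.card) :
    ∃ e : Fin k → ι, (∀ i, e i ∈ T) ∧ StrictMono (f ∘ e) ∧
      (StrictMono (g ∘ e) ∨ StrictAnti (g ∘ e)) := by
  cases k with
  | zero =>
    exact ⟨Fin.elim0, fun i => i.elim0, fun i => i.elim0, Or.inl fun i => i.elim0⟩
  | succ k =>
    have : k * k < T.card := by nlinarith
    rcases exists_monotone_or_antitone_subset f g k k T hf hg this with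
      ⟨U, hUT, hU, h⟩ | ⟨U, hUT, hU, h⟩
    · obtain ⟨e, he, hmono⟩ := exists_strictMono_enumeration f U (hf.mono hUT) hU
      exact ⟨e, fun i => hUT (he i), hmono,
        Or.inl fun i j hij => h _ (he i) _ (he j) (hmono hij)⟩
    · obtain ⟨e, he, hmono⟩ := exists_strictMono_enumeration f U (hf.mono hUT) hU
      exact ⟨e, fun i => hUT (he i), hmono,
        Or.inr fun i j hij => h _ (he i) _ (he j) (hmono hij)⟩

/-! ### Matchings without crossings -/

/-- Add the triangle inequalities through `x`. Equality would put `x` on the segment from `a` to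
`b'` too; then `a` lies on the second segment if `x = a`, and otherwise `b` and `b'` are on the line
through `a` and `x`. -/
theorem dist_add_dist_lt_of_segments_meet {a b a' b' x : Plane}
    (h1 : ¬ Collinear ℝ ({b, a, b'} : Set Plane)) (h2 : ¬ Collinear ℝ ({a, a', b'} : Set Plane))
    (hx : x ∈ segment ℝ a b) (hx' : x ∈ segment ℝ a' b') :
    dist a b' + dist a' b < dist a b + dist a' b' := by
  have e1 := dist_add_dist_of_mem_segment hx
  have e2 := dist_add_dist_of_mem_segment hx'
  have t1 := dist_triangle a x b'
  have t2 := dist_triangle a' x b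
  refine lt_of_le_of_ne (by linarith) fun heq => ?_
  have e3 : dist a x + dist x b' = dist a b' := by linarith
  have hw : Wbtw ℝ a x b' := dist_add_dist_eq_iff.1 e3
  have hc1 : Wbtw ℝ a x b := dist_add_dist_eq_iff.1 e1
  have hc2 : Wbtw ℝ a' x b' := dist_add_dist_eq_iff.1 e2
  by_cases hxa : x = a
  · subst hxa
    apply h2
    have := hc2.collinear
    rwa [Set.insert_comm] at this
  · apply h1
    have hb : b ∈ line[ℝ, a, x] := hc1.collinear.mem_affineSpan_of_mem_of_ne (by simp) (by simp)
      (by simp) (Ne.symm hxa)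
    have hb' : b' ∈ line[ℝ, a, x] := hw.collinear.mem_affineSpan_of_mem_of_ne (by simp) (by simp)
      (by simp) (Ne.symm hxa)
    exact collinear_triple_of_mem_affineSpan_pair hb (left_mem_affineSpan_pair ℝ _ _) hb'

/-- In a matching of least total length, exchanging the partners of two segments that meet would
shorten it. -/
theorem exists_noncrossing_matching (A C : Finset Plane) (hcard : A.card = C.card)
    (hdisj : Disjoint A C) (hgp : GeneralPosition (A ∪ C)) :
    ∃ e : Plane → Plane, (∀ a ∈ A, e a ∈ C) ∧ ∀ a ∈ A, ∀ a' ∈ A, a ≠ a' →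
      e a ≠ e a' ∧ Disjoint (segment ℝ a (e a)) (segment ℝ a' (e a')) := by
  classical
  have : Nonempty (A ≃ C) := Fintype.card_eq.1 (by simpa using hcard)
  obtain ⟨φ, -, hφ⟩ := Finset.exists_min_image (Finset.univ : Finset (A ≃ C))
    (fun φ => ∑ a : A, dist (a : Plane) (φ a)) Finset.univ_nonempty
  refine ⟨fun a => if h : a ∈ A then φ ⟨a, h⟩ else a, fun a ha => by simp [ha], ?_⟩
  intro a ha a' ha' hne
  simp only [ha, ha', dif_pos]
  have hne' : (⟨a, ha⟩ : A) ≠ ⟨a', ha'⟩ := fun h => hne (congrArg Subtype.val h)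
  have hee : (φ ⟨a, ha⟩ : Plane) ≠ φ ⟨a', ha'⟩ := fun h =>
    hne' (φ.injective (Subtype.ext h))
  refine ⟨hee, ?_⟩
  rw [Set.disjoint_left]
  intro x hx hx'
  have hAC : ∀ u ∈ A, ∀ v : C, u ≠ v := fun u hu v h =>
    Finset.disjoint_left.1 hdisj hu (h ▸ v.2)
  have hlt := dist_add_dist_lt_of_segments_meet
    (hgp _ (Finset.mem_union_right _ (φ ⟨a, ha⟩).2) a (Finset.mem_union_left _ ha) _
      (Finset.mem_union_right _ (φ ⟨a', ha'⟩).2) (hAC a ha _).symm hee (hAC a ha _))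
    (hgp a (Finset.mem_union_left _ ha) a' (Finset.mem_union_left _ ha') _
      (Finset.mem_union_right _ (φ ⟨a', ha'⟩).2) hne (hAC a ha _) (hAC a' ha' _)) hx hx'
  have hmin := hφ ((Equiv.swap ⟨a, ha⟩ ⟨a', ha'⟩).trans φ) (Finset.mem_univ _)
  refine absurd hmin (not_le.2 ?_)
  have hsplit : ∀ g : A → ℝ, ∑ u : A, g u =
      g ⟨a, ha⟩ + (g ⟨a', ha'⟩ +
        ∑ u ∈ ((Finset.univ : Finset A).erase ⟨a, ha⟩).erase ⟨a', ha'⟩, g u) := by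
    intro g
    rw [Finset.add_sum_erase _ g (by simp [hne'.symm]), Finset.add_sum_erase _ g (by simp)]
  rw [hsplit, hsplit (fun u => dist (u : Plane) (φ u))]
  have hrest : ∑ u ∈ ((Finset.univ : Finset A).erase ⟨a, ha⟩).erase ⟨a', ha'⟩,
        dist (u : Plane) (((Equiv.swap ⟨a, ha⟩ ⟨a', ha'⟩).trans φ) u) =
      ∑ u ∈ ((Finset.univ : Finset A).erase ⟨a, ha⟩).erase ⟨a', ha'⟩, dist (u : Plane) (φ u) := by
    refine Finset.sum_congr rfl fun u hu => ?_
    simp only [Finset.mem_erase, Finset.mem_univ, and_true] at hu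
    rw [Equiv.trans_apply, Equiv.swap_apply_of_ne_of_ne hu.2 hu.1]
  rw [hrest]
  simp only [Equiv.trans_apply, Equiv.swap_apply_left, Equiv.swap_apply_right]
  linarith

/-! ### Splitting a set of points by a line -/

/-- Take the first point with at least `m` points up to it: fewer than `m` come strictly before, so
by injectivity at most `m` come up to it. -/
theorem exists_halving_value (f : Plane → ℝ) (R : Finset Plane) (hf : Set.InjOn f R) {m : ℕ}
    (hm : 1 ≤ m) (hmR : m ≤ R.card) :
    ∃ r ∈ R, m ≤ (R.filter fun q => f q ≤ f r).card ∧
      R.card - m ≤ (R.filter fun q => f r < f q).card := by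
  classical
  have hne : (R.filter fun r => m ≤ (R.filter fun q => f q ≤ f r).card).Nonempty := by
    obtain ⟨r, hr, hmax⟩ := Finset.exists_max_image R f (Finset.card_pos.1 (by omega))
    refine ⟨r, Finset.mem_filter.2 ⟨hr, ?_⟩⟩
    rwa [Finset.filter_true_of_mem hmax]
  obtain ⟨r, hr, hmin⟩ := Finset.exists_min_image _ f hne
  rw [Finset.mem_filter] at hr
  refine ⟨r, hr.1, hr.2, ?_⟩
  have hlt : (R.filter fun q => f q < f r).card < m := by
    by_contra hcon
    push Not at hcon
    obtain ⟨s, hs, hsmax⟩ := Finset.exists_max_image (R.filter fun q => f q < f r) f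
      (Finset.card_pos.1 (by omega))
    have hs' := Finset.mem_filter.1 hs
    refine absurd (hmin s (Finset.mem_filter.2 ⟨hs'.1, hcon.trans (Finset.card_le_card ?_)⟩))
      (not_le.2 hs'.2)
    intro q hq
    exact Finset.mem_filter.2 ⟨(Finset.mem_filter.1 hq).1, hsmax q hq⟩
  have hle : (R.filter fun q => f q ≤ f r).card ≤ (R.filter fun q => f q < f r).card + 1 := by
    refine (Finset.card_le_card (t := insert r (R.filter fun q => f q < f r)) ?_).trans
      (Finset.card_insert_le _ _)
    intro q hq
    obtain ⟨h1, h2⟩ := Finset.mem_filter.1 hq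
    rcases h2.lt_or_eq with h | h
    · exact Finset.mem_insert_of_mem (Finset.mem_filter.2 ⟨h1, h⟩)
    · rw [hf h1 hr.1 h]; exact Finset.mem_insert_self _ _
  have hsum := Finset.card_filter_add_card_filter_not (s := R) (fun q => f q ≤ f r)
  simp only [not_le] at hsum
  omega

/-- Some value of `f` separates half of one colour class from half of the other one. -/
theorem exists_separated_halves (f : Plane → ℝ) (R B : Finset Plane) {n : ℕ} (hn : 1 ≤ n)
    (hR : R.card = n) (hB : B.card = n) (hf : Set.InjOn f R) :
    ∃ (c : ℝ) (A C : Finset Plane), A.card = n / 2 ∧ C.card = n / 2 ∧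
      ((A ⊆ R ∧ C ⊆ B) ∨ (A ⊆ B ∧ C ⊆ R)) ∧ (∀ a ∈ A, f a ≤ c) ∧ ∀ b ∈ C, c < f b := by
  classical
  -- With `m = (n + 1) / 2` both sides contain at least `n / 2` red points, so whichever side has
  -- enough blue points can be used.
  obtain ⟨r, -, h1, h2⟩ := exists_halving_value f R hf (m := (n + 1) / 2) (by omega) (by omega)
  have hsum := Finset.card_filter_add_card_filter_not (s := B) (fun q => f q ≤ f r)
  simp only [not_le] at hsum
  by_cases hB' : n / 2 ≤ (B.filter fun q => f r < f q).card
  · obtain ⟨C, hC, hCc⟩ := Finset.exists_subset_card_eq hB'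
    obtain ⟨A, hA, hAc⟩ := Finset.exists_subset_card_eq (show n / 2 ≤ _ by omega : n / 2 ≤
      (R.filter fun q => f q ≤ f r).card)
    exact ⟨f r, A, C, hAc, hCc, Or.inl ⟨hA.trans (Finset.filter_subset _ _),
      hC.trans (Finset.filter_subset _ _)⟩, fun a ha => (Finset.mem_filter.1 (hA ha)).2,
      fun a ha => (Finset.mem_filter.1 (hC ha)).2⟩
  · obtain ⟨C, hC, hCc⟩ := Finset.exists_subset_card_eq (show n / 2 ≤ _ by omega : n / 2 ≤
      (R.filter fun q => f r < f q).card)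
    obtain ⟨A, hA, hAc⟩ := Finset.exists_subset_card_eq (show n / 2 ≤ _ by omega : n / 2 ≤
      (B.filter fun q => f q ≤ f r).card)
    exact ⟨f r, A, C, hAc, hCc, Or.inr ⟨hA.trans (Finset.filter_subset _ _),
      hC.trans (Finset.filter_subset _ _)⟩, fun a ha => (Finset.mem_filter.1 (hA ha)).2,
      fun a ha => (Finset.mem_filter.1 (hC ha)).2⟩


/-! ### Alternating lists and the lower bound -/

/-- The list `q (a + l - 1), p (a + l - 1), …, q a, p a`. -/
def zigzag (p q : ℕ → Plane) (a : ℕ) : ℕ → List Plane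
  | 0 => []
  | l + 1 => q (a + l) :: p (a + l) :: zigzag p q a l

theorem mem_zigzag {p q : ℕ → Plane} {a l : ℕ} {u : Plane} (hu : u ∈ zigzag p q a l) :
    ∃ i, a ≤ i ∧ i < a + l ∧ (u = p i ∨ u = q i) := by
  induction l with
  | zero => simp [zigzag] at hu
  | succ l ih =>
    rw [zigzag, List.mem_cons, List.mem_cons] at hu
    rcases hu with rfl | rfl | hu
    · exact ⟨a + l, by omega, by omega, Or.inr rfl⟩
    · exact ⟨a + l, by omega, by omega, Or.inl rfl⟩
    · obtain ⟨i, h1, h2, h3⟩ := ih hu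
      exact ⟨i, h1, by omega, h3⟩

theorem zigzag_pairwise {β : Type*} [Preorder β] (K : Plane → β) {p q : ℕ → Plane} {a l : ℕ}
    (h1 : ∀ i, a ≤ i → i < a + l → K (p i) < K (q i))
    (h2 : ∀ i j, a ≤ i → i < j → j < a + l → K (q i) < K (p j)) :
    (zigzag p q a l).Pairwise (fun u v => K v < K u) := by
  induction l with
  | zero => simp [zigzag]
  | succ l ih =>
    have hp : ∀ u ∈ zigzag p q a l, K u < K (p (a + l)) := by
      intro u hu
      obtain ⟨i, hi1, hi2, rfl | rfl⟩ := mem_zigzag hu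
      · exact (h1 i hi1 (by omega)).trans (h2 i (a + l) hi1 hi2 (by omega))
      · exact h2 i (a + l) hi1 hi2 (by omega)
    have hpq := h1 (a + l) (by omega) (by omega)
    rw [zigzag, List.pairwise_cons, List.pairwise_cons]
    refine ⟨?_, hp, ih (fun i g1 g2 => h1 i g1 (by omega))
      (fun i j g1 g2 g3 => h2 i j g1 g2 (by omega))⟩
    intro u hu
    rcases List.mem_cons.1 hu with rfl | hu
    · exact hpq
    · exact (hp u hu).trans hpq

theorem le_linearChanges_zigzag_of_red (col : Plane → Color) {p q : ℕ → Plane} {a l : ℕ}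
    (hp : ∀ i, a ≤ i → i < a + l → col (p i) = Color.blue)
    (hq : ∀ i, a ≤ i → i < a + l → col (q i) = Color.red) :
    l ≤ linearChanges ((zigzag p q a l).map col) := by
  classical
  induction l with
  | zero => simp
  | succ l ih =>
    have := ih (fun i h1 h2 => hp i h1 (by omega)) (fun i h1 h2 => hq i h1 (by omega))
    rw [zigzag, List.map_cons, List.map_cons, hp (a + l) (by omega) (by omega),
      hq (a + l) (by omega) (by omega), linearChanges_cons_cons, linearChanges_blue_cons]
    simpa using this

/-- The list begins with a blue point, which costs one change; a red letter put in front restores it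
for the induction. -/
theorem le_linearChanges_zigzag_of_blue (col : Plane → Color) {p q : ℕ → Plane} {a l : ℕ}
    (hp : ∀ i, a ≤ i → i < a + l → col (p i) = Color.red)
    (hq : ∀ i, a ≤ i → i < a + l → col (q i) = Color.blue) :
    l - 1 ≤ linearChanges ((zigzag p q a l).map col) := by
  classical
  have key : ∀ l : ℕ, (∀ i, a ≤ i → i < a + l → col (p i) = Color.red) →
      (∀ i, a ≤ i → i < a + l → col (q i) = Color.blue) →
      l ≤ linearChanges (Color.red :: (zigzag p q a l).map col) := by
    intro l hp hq
    induction l with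
    | zero => simp
    | succ l ih =>
      have := ih (fun i h1 h2 => hp i h1 (by omega)) (fun i h1 h2 => hq i h1 (by omega))
      rw [zigzag, List.map_cons, List.map_cons, hp (a + l) (by omega) (by omega),
        hq (a + l) (by omega) (by omega), linearChanges_cons_cons, linearChanges_blue_cons]
      simpa using this
  cases l with
  | zero => simp
  | succ l =>
    rw [zigzag, List.map_cons, List.map_cons, hp (a + l) (by omega) (by omega),
      hq (a + l) (by omega) (by omega), linearChanges_blue_cons]
    simpa using key l (fun i h1 h2 => hp i h1 (by omega)) (fun i h1 h2 => hq i h1 (by omega))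

namespace Frame

theorem exists_injOn_X (S : Finset Plane) : ∃ F : Frame, Set.InjOn F.X S := by
  classical
  obtain ⟨ε, hε⟩ := Infinite.exists_notMem_finset
    ((S ×ˢ S).image fun u => -(u.1 0 - u.2 0) / (u.1 1 - u.2 1))
  refine ⟨⟨1, ε, one_mul 1⟩, ?_⟩
  intro p hp q hq h
  simp only [X, one_mul] at h
  by_cases h1 : p 1 = q 1
  · exact plane_ext (by rw [h1] at h; linarith) h1
  · refine absurd (Finset.mem_image.2 ⟨(p, q), Finset.mk_mem_product hp hq, ?_⟩) hε
    have : p 1 - q 1 ≠ 0 := sub_ne_zero.2 h1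
    simp only
    field_simp
    linarith

theorem key_lt (F : Frame) (t : Plane → ℝ) {u v : Plane} (huv : t u < t v)
    (h : (0 < t u ∧ 0 < t v) ∨ (t u < 0 ∧ t v < 0)) :
    key (fun p => F.dir (t p)) u < key (fun p => F.dir (t p)) v :=
  key_lt_of_directionAngle_lt (F.directionAngle_dir_lt huv h)

/-- Slopes are compared with angles only when they have the same sign, since for leftward directions
the branch cut is at slope zero. The sign at the middle index decides which half of the indices is
kept. -/
theorem le_alternationNumber_of_alternating (F : Frame) {R B : Finset Plane} (hRB : Disjoint R B)
    {t : Plane → ℝ} (h0 : ∀ u ∈ R ∪ B, t u ≠ 0) {k : ℕ} {p q : ℕ → Plane}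
    (hcol : (∀ i < k, p i ∈ R ∧ q i ∈ B) ∨ (∀ i < k, p i ∈ B ∧ q i ∈ R))
    (h1 : ∀ i < k, t (p i) < t (q i)) (h2 : ∀ i j, i < j → j < k → t (q i) < t (p j)) :
    k / 2 - 1 ≤ alternationNumber (circularSequence R B fun u => F.dir (t u)) := by
  classical
  have hmem : ∀ i < k, p i ∈ R ∪ B ∧ q i ∈ R ∪ B := by
    intro i hi
    rcases hcol with h | h
    · exact ⟨Finset.mem_union_left _ (h i hi).1, Finset.mem_union_right _ (h i hi).2⟩
    · exact ⟨Finset.mem_union_right _ (h i hi).1, Finset.mem_union_left _ (h i hi).2⟩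
  have hmono : ∀ i j, i ≤ j → j < k → t (p i) ≤ t (p j) := by
    intro i j hij hj
    rcases hij.lt_or_eq with h | rfl
    · exact ((h1 i (by omega)).trans (h2 i j h hj)).le
    · exact le_rfl
  -- it suffices to find a run of indices on which the slopes have constant sign
  have main : ∀ a l : ℕ, a + l ≤ k → ((∀ i, a ≤ i → i < a + l → 0 < t (p i)) ∨
      (∀ i, a ≤ i → i < a + l → t (q i) < 0)) →
      l - 1 ≤ alternationNumber (circularSequence R B fun u => F.dir (t u)) := by
    intro a l hal hsign
    have hpair : (zigzag p q a l).Pairwise fun u v =>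
        key (fun u => F.dir (t u)) v < key (fun u => F.dir (t u)) u := by
      apply zigzag_pairwise
      · intro i hi hi'
        have g := h1 i (by omega)
        refine F.key_lt t g ?_
        rcases hsign with h | h
        · exact Or.inl ⟨h i hi hi', (h i hi hi').trans g⟩
        · exact Or.inr ⟨g.trans (h i hi hi'), h i hi hi'⟩
      · intro i j hi hij hj
        have g := h2 i j hij (by omega)
        refine F.key_lt t g ?_
        rcases hsign with h | h
        · have := h i hi (by omega)
          have g' := h1 i (by omega)
          exact Or.inl ⟨by linarith, by linarith⟩
        · have := h j (by omega) hj
          have g' := h1 j (by omega)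
          exact Or.inr ⟨by linarith, by linarith⟩
    refine le_trans ?_ (linearChanges_le_alternationNumber (zigzag p q a l) ?_ hpair)
    · have hR : ∀ u ∈ R, colorOf R u = Color.red := fun u hu => by simp [colorOf, hu]
      have hB : ∀ u ∈ B, colorOf R u = Color.blue := fun u hu => by
        simp [colorOf, Finset.disjoint_right.1 hRB hu]
      rcases hcol with h | h
      · exact le_linearChanges_zigzag_of_blue _ (fun i _ hi => hR _ (h i (by omega)).1)
          (fun i _ hi => hB _ (h i (by omega)).2)
      · exact (Nat.sub_le _ _).trans (le_linearChanges_zigzag_of_red _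
          (fun i _ hi => hB _ (h i (by omega)).1) (fun i _ hi => hR _ (h i (by omega)).2))
    · intro u hu
      obtain ⟨i, hi1, hi2, rfl | rfl⟩ := mem_zigzag hu
      · exact (hmem i (by omega)).1
      · exact (hmem i (by omega)).2
  rcases Nat.eq_zero_or_pos k with rfl | hk
  · simp
  rcases lt_or_gt_of_ne (h0 _ (hmem (k / 2) (by omega)).1) with h | h
  · refine main 0 (k / 2) (by omega) (Or.inr fun i _ hi => ?_)
    exact (h2 i (k / 2) (by omega) (by omega)).trans h
  · refine le_trans ?_ (main (k / 2) (k - k / 2) (by omega) (Or.inl fun i hi hi' => ?_))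
    · omega
    · exact h.trans_le (hmono (k / 2) i hi (by omega))

end Frame

theorem StrongGeneralPosition.cross_ne_zero {S : Finset Plane} (h : StrongGeneralPosition S)
    {p q u w : Plane} (hp : p ∈ S) (hq : q ∈ S) (hu : u ∈ S) (hw : w ∈ S) (hpq : p ≠ q)
    (huw : u ≠ w) (hne : ({p, q} : Set Plane) ≠ {u, w}) : cross (q - p) (w - u) ≠ 0 := fun h0 =>
  h.2 p hp q hq u hu w hw hpq huw hne ((parallel_iff_cross hpq huw).2 h0)

/-- Every balanced set in strong general position admits a ray system with many alternations. -/
theorem exists_raySystem_many_alternations {n : ℕ} (hn : 1 ≤ n) {R B : Finset Plane}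
    (hR : R.card = n) (hB : B.card = n) (hRB : Disjoint R B)
    (hS : StrongGeneralPosition (R ∪ B)) :
    ∃ d : Plane → Plane, IsDisjointRaySystem (R ∪ B) d ∧
      Nat.sqrt (n / 2) / 2 - 1 ≤ alternationNumber (circularSequence R B d) := by
  classical
  obtain ⟨F, hF⟩ := Frame.exists_injOn_X (R ∪ B)
  obtain ⟨c, A, C, hA, hC, hAC, hAc, hCc⟩ := exists_separated_halves F.X R B hn hR hB
    (hF.mono (by simp))
  have hAS : A ⊆ R ∪ B := by
    rcases hAC with h | h
    · exact h.1.trans Finset.subset_union_left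
    · exact h.1.trans Finset.subset_union_right
  have hCS : C ⊆ R ∪ B := by
    rcases hAC with h | h
    · exact h.2.trans Finset.subset_union_right
    · exact h.2.trans Finset.subset_union_left
  have hne : ∀ a ∈ A, ∀ b ∈ C, a ≠ b := by
    rintro a ha b hb rfl
    exact absurd (hAc a ha) (not_le.2 (hCc a hb))
  obtain ⟨e, heC, he⟩ := exists_noncrossing_matching A C (hA.trans hC.symm)
    (Finset.disjoint_left.2 fun a ha hb => hne a ha a hb rfl)
    (fun p hp q hq u hu => hS.1 p (Finset.union_subset hAS hCS hp) q
      (Finset.union_subset hAS hCS hq) u (Finset.union_subset hAS hCS hu))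
  set τ : Plane → ℝ := fun a => (F.Y (e a) - F.Y a) / (F.X (e a) - F.X a) with hτdef
  have hlt : ∀ a ∈ A, F.X a < F.X (e a) := fun a ha => (hAc a ha).trans_lt (hCc _ (heC a ha))
  have hτ : ∀ a ∈ A, F.Y (e a) = F.Y a + τ a * (F.X (e a) - F.X a) := by
    intro a ha
    have : F.X (e a) - F.X a ≠ 0 := by linarith [hlt a ha]
    simp only [hτdef]
    field_simp
    ring
  set f : Plane → ℝ := fun a => F.Y a + τ a * (c - F.X a) with hf
  have hfinj : Set.InjOn f A := by
    intro a ha a' ha' h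
    by_contra hcon
    obtain ⟨z, hz, hzX, hzY⟩ := F.exists_mem_segment (hlt a ha) (hτ a ha) (hAc a ha)
      (hCc _ (heC a ha)).le
    obtain ⟨z', hz', hzX', hzY'⟩ := F.exists_mem_segment (hlt a' ha') (hτ a' ha') (hAc a' ha')
      (hCc _ (heC a' ha')).le
    have : z = z' := F.ext_XY (hzX.trans hzX'.symm) (hzY.trans (h.trans hzY'.symm))
    subst this
    exact Set.disjoint_left.1 (he a ha a' ha' hcon).2 hz hz'
  have hτinj : Set.InjOn τ A := by
    intro a ha a' ha' h
    by_contra hcon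
    refine hS.cross_ne_zero (hAS ha) (hCS (heC a ha)) (hAS ha') (hCS (heC a' ha'))
      (hne a ha _ (heC a ha)) (hne a' ha' _ (heC a' ha')) ?_ ?_
    · intro hset
      have : a ∈ ({a', e a'} : Set Plane) := hset ▸ Set.mem_insert _ _
      rcases this with h | h
      · exact hcon h
      · exact hne a ha _ (heC a' ha') h
    · rw [F.cross_eq, F.X_sub, F.X_sub, F.Y_sub, F.Y_sub, hτ a ha, hτ a' ha', h]
      ring
  obtain ⟨k, hk⟩ : ∃ k, k = Nat.sqrt (n / 2) := ⟨_, rfl⟩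
  rw [← hk]
  obtain ⟨idx, hidx, hfm, hτm⟩ := exists_monotone_or_antitone_enumeration f τ A hfinj hτinj
    k (by rw [hA, hk]; exact Nat.sqrt_le _)
  have hidxinj : Function.Injective idx := fun i j h =>
    hfm.injective (by simp only [Function.comp, h])
  -- a fan with alternating ends yields the conclusion
  have finish : ∀ (G : Frame) (p q : Fin k → Plane) (t : Plane → ℝ),
      ((∀ i, p i ∈ R ∧ q i ∈ B) ∨ (∀ i, p i ∈ B ∧ q i ∈ R)) → G.Fan (R ∪ B) t →
      (∀ u ∈ R ∪ B, t u ≠ 0) → (∀ i, t (p i) < t (q i)) →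
      (∀ i j, i < j → t (q i) < t (p j)) →
      ∃ d : Plane → Plane, IsDisjointRaySystem (R ∪ B) d ∧
      k / 2 - 1 ≤ alternationNumber (circularSequence R B d) := by
    intro G p q t hcol hfan h0 h1 h2
    refine ⟨_, hfan.isDisjointRaySystem, ?_⟩
    refine G.le_alternationNumber_of_alternating hRB h0
      (p := fun i => if h : i < k then p ⟨i, h⟩ else 0)
      (q := fun i => if h : i < k then q ⟨i, h⟩ else 0) ?_ ?_ ?_
    · rcases hcol with h | h
      · left; intro i hi; simp only [hi, dif_pos]; exact h _
      · right; intro i hi; simp only [hi, dif_pos]; exact h _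
    · intro i hi; simp only [hi, dif_pos]; exact h1 _
    · intro i j hij hj
      have hi : i < k := hij.trans hj
      simp only [hi, hj, dif_pos]
      exact h2 _ _ hij
  rcases hτm with hτm | hτm
  · obtain ⟨t, ht1, ht2, ht3, ht4⟩ := F.exists_fan_alternating (R ∪ B) c idx (fun i => e (idx i))
      (fun i => τ (idx i)) (fun i => hAS (hidx i)) (fun i => hCS (heC _ (hidx i)))
      (fun i j => (hne _ (hidx j) _ (heC _ (hidx i))).symm) (fun i => hAc _ (hidx i))
      (fun i => (hCc _ (heC _ (hidx i))).le) (fun i => hlt _ (hidx i)) (fun i => hτ _ (hidx i))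
      hτm hfm (fun i j hij => (he _ (hidx i) _ (hidx j) (hidxinj.ne hij)).2)
    refine finish F _ _ t ?_ ht1 ht2 ht3 ht4
    rcases hAC with h | h
    · exact Or.inl fun i => ⟨h.1 (hidx i), h.2 (heC _ (hidx i))⟩
    · exact Or.inr fun i => ⟨h.1 (hidx i), h.2 (heC _ (hidx i))⟩
  -- The half turn negates heights but not slopes, so with the indices reversed both increase; the
  -- points of `C` are now the left ends.
  · obtain ⟨t, ht1, ht2, ht3, ht4⟩ := F.neg.exists_fan_alternating (R ∪ B) (-c)
      (fun i => e (idx i.rev)) (fun i => idx i.rev) (fun i => τ (idx i.rev))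
      (fun i => hCS (heC _ (hidx _))) (fun i => hAS (hidx _))
      (fun i j => hne _ (hidx _) _ (heC _ (hidx _)))
      (fun i => by rw [F.neg_X]; linarith [hCc _ (heC _ (hidx i.rev))])
      (fun i => by rw [F.neg_X]; linarith [hAc _ (hidx i.rev)])
      (fun i => by rw [F.neg_X, F.neg_X]; linarith [hlt _ (hidx i.rev)])
      (fun i => by
        rw [F.neg_X, F.neg_X, F.neg_Y, F.neg_Y]
        linear_combination hτ _ (hidx i.rev))
      (fun i j hij => hτm (Fin.rev_lt_rev.2 hij))
      (fun i j hij => by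
        have h : f (idx j.rev) < f (idx i.rev) := hfm (Fin.rev_lt_rev.2 hij)
        simp only [hf] at h
        simp only [F.neg_X, F.neg_Y]
        linarith [hτ _ (hidx i.rev), hτ _ (hidx j.rev)])
      (fun i j hij => by
        rw [segment_symm ℝ (e _), segment_symm ℝ (e _)]
        exact (he _ (hidx _) _ (hidx _) (hidxinj.ne (Fin.rev_injective.ne hij))).2)
    refine finish F.neg _ _ t ?_ ht1 ht2 ht3 ht4
    rcases hAC with h | h
    · exact Or.inr fun i => ⟨h.2 (heC _ (hidx _)), h.1 (hidx _)⟩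
    · exact Or.inl fun i => ⟨h.2 (heC _ (hidx _)), h.1 (hidx _)⟩

/-- The bound `1 ≤ a` absorbs the additive losses, including the truncated subtraction for small
`n`; the constants are generous. -/
theorem sqrt_le_alternation {n a : ℕ} (ha : 1 ≤ a) (h : Nat.sqrt (n / 2) / 2 - 1 ≤ a) :
    1 / 20 * Real.sqrt n ≤ a := by
  set k := Nat.sqrt (n / 2) with hk
  have h1 : n / 2 < (k + 1) * (k + 1) := Nat.lt_succ_sqrt _
  have h2 : n ≤ 2 * ((k + 1) * (k + 1)) := by omega
  have h3 : k + 1 ≤ 10 * a := by omega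
  have h4 : n ≤ 400 * (a * a) := by nlinarith
  have h5 : Real.sqrt n ≤ 20 * a := by
    apply Real.sqrt_le_iff.2
    refine ⟨by positivity, ?_⟩
    have : (n : ℝ) ≤ 400 * (a * a) := by exact_mod_cast h4
    nlinarith
  linarith


/-! ### Choosing points in strong general position -/

/-- Distinct pairs of distinct points of `T` span lines that are not parallel. -/
def PairwiseNonparallel (T : Finset Plane) : Prop :=
  ∀ p ∈ T, ∀ q ∈ T, ∀ u ∈ T, ∀ w ∈ T, p ≠ q → u ≠ w → ({p, q} : Set Plane) ≠ {u, w} →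
    cross (q - p) (w - u) ≠ 0

theorem PairwiseNonparallel.mono {S T : Finset Plane} (h : PairwiseNonparallel T) (hST : S ⊆ T) :
    PairwiseNonparallel S := fun p hp q hq u hu w hw =>
  h p (hST hp) q (hST hq) u (hST hu) w (hST hw)

theorem PairwiseNonparallel.cross_ne_zero {T : Finset Plane} (h : PairwiseNonparallel T)
    {p q u : Plane} (hp : p ∈ T) (hq : q ∈ T) (hu : u ∈ T) (hpq : p ≠ q) (hpu : p ≠ u)
    (hqu : q ≠ u) : cross (q - p) (u - p) ≠ 0 := by
  refine h p hp q hq p hp u hu hpq hpu fun hset => ?_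
  have : q ∈ ({p, u} : Set Plane) := hset ▸ Set.mem_insert_of_mem _ rfl
  rcases this with h | h
  · exact hpq h.symm
  · exact hqu h

theorem PairwiseNonparallel.strongGeneralPosition {T : Finset Plane}
    (h : PairwiseNonparallel T) : StrongGeneralPosition T := by
  refine ⟨fun p hp q hq u hu hpq hpu hqu hcol => ?_, fun p hp q hq u hu w hw hpq huw hne hpar => ?_⟩
  · exact h.cross_ne_zero hp hq hu hpq hpu hqu ((collinear_iff_cross hpq).1 hcol)
  · exact h p hp q hq u hu w hw hpq huw hne ((parallel_iff_cross hpq huw).1 hpar)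

theorem cross_sub_comm (u v p q : Plane) : cross (u - v) (p - q) = -cross (v - u) (p - q) := by
  simp [cross]; ring

theorem cross_sub_comm' (u v p q : Plane) : cross (u - v) (p - q) = -cross (u - v) (q - p) := by
  simp [cross]; ring

theorem cross_swap (u v : Plane) : cross u v = -cross v u := by
  simp [cross]; ring

/-- Letting `p` be an end of the chord from `q` to `u` also keeps `x` off the line of that chord,
which settles two pairs that share `x`. -/
theorem PairwiseNonparallel.insert {T : Finset Plane} (h : PairwiseNonparallel T) {x : Plane}
    [DecidableEq Plane] (hx : ∀ p ∈ T, ∀ q ∈ T, ∀ u ∈ T, q ≠ u → cross (x - p) (u - q) ≠ 0) :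
    PairwiseNonparallel (insert x T) := by
  have hxx : ∀ p ∈ T, ∀ q ∈ T, p ≠ q → cross (p - x) (q - x) ≠ 0 := by
    intro p hp q hq hpq h0
    refine hx p hp p hp q hq hpq ?_
    simp [cross] at h0 ⊢
    linarith
  intro p ip q iq u iu w iw hpq huw hne
  rcases Finset.mem_insert.1 ip with h1 | hp <;> rcases Finset.mem_insert.1 iq with h2 | hq
  · exact absurd (h1.trans h2.symm) hpq
  · subst h1
    rcases Finset.mem_insert.1 iu with h3 | hu <;> rcases Finset.mem_insert.1 iw with h4 | hw
    · exact absurd (h3.trans h4.symm) huw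
    · subst h3
      exact hxx q hq w hw fun h => hne (by rw [h])
    · subst h4
      rw [cross_sub_comm', neg_ne_zero]
      exact hxx q hq u hu fun h => hne (by rw [h, Set.pair_comm])
    · rw [cross_sub_comm, neg_ne_zero]
      exact hx q hq u hu w hw huw
  · subst h2
    rcases Finset.mem_insert.1 iu with h3 | hu <;> rcases Finset.mem_insert.1 iw with h4 | hw
    · exact absurd (h3.trans h4.symm) huw
    · subst h3
      rw [cross_sub_comm, neg_ne_zero]
      exact hxx p hp w hw fun h => hne (by rw [h, Set.pair_comm])
    · subst h4
      rw [cross_sub_comm, cross_sub_comm', neg_neg]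
      exact hxx p hp u hu fun h => hne (by rw [h])
    · exact hx p hp u hu w hw huw
  · rcases Finset.mem_insert.1 iu with h3 | hu <;> rcases Finset.mem_insert.1 iw with h4 | hw
    · exact absurd (h3.trans h4.symm) huw
    · subst h3
      rw [cross_swap, cross_sub_comm, neg_neg]
      exact hx w hw p hp q hq hpq
    · subst h4
      rw [cross_swap, neg_ne_zero]
      exact hx u hu p hp q hq hpq
    · exact h p hp q hq u hu w hw hpq huw hne

theorem continuous_cross {α : Type*} [TopologicalSpace α] {f g : α → Plane} (hf : Continuous f)
    (hg : Continuous g) : Continuous fun x => cross (f x) (g x) := by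
  unfold cross
  fun_prop

theorem dense_cross_ne_zero (p : Plane) {d : Plane} (hd : d ≠ 0) :
    Dense {x : Plane | cross (x - p) d ≠ 0} := by
  rw [Metric.dense_iff]
  intro x r hr
  by_cases hx : cross (x - p) d = 0
  · set w : Plane := !₂[d 1, -d 0] with hw
    have hw0 : w 0 = d 1 := by simp [hw]
    have hw1 : w 1 = -d 0 := by simp [hw]
    have hwd : cross w d ≠ 0 := by
      rw [cross, hw0, hw1]
      intro h
      refine hd (plane_ext ?_ ?_)
      · exact mul_self_eq_zero.1 (by nlinarith [mul_self_nonneg (d 0), mul_self_nonneg (d 1)])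
      · exact mul_self_eq_zero.1 (by nlinarith [mul_self_nonneg (d 0), mul_self_nonneg (d 1)])
    have hwn : 0 < ‖w‖ := norm_pos_iff.2 fun h => hwd (by rw [h]; simp [cross])
    refine ⟨x + (r / (2 * ‖w‖)) • w, ?_, ?_⟩
    · rw [Metric.mem_ball, dist_eq_norm, add_sub_cancel_left, norm_smul, Real.norm_eq_abs,
        abs_of_pos (by positivity)]
      field_simp
      norm_num
    · have : cross (x + (r / (2 * ‖w‖)) • w - p) d =
          cross (x - p) d + (r / (2 * ‖w‖)) * cross w d := by
        simp [cross]; ring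
      rw [Set.mem_ofPred_eq, this, hx, zero_add]
      exact mul_ne_zero (by positivity) hwd
  · exact ⟨x, Metric.mem_ball_self hr, hx⟩

/-- Only finitely many lines and points are forbidden; the complement of each is open and dense. -/
theorem PairwiseNonparallel.exists_insert {T : Finset Plane} (h : PairwiseNonparallel T)
    [DecidableEq Plane] (c : Plane) {ε : ℝ} (hε : 0 < ε) :
    ∃ x ∈ Metric.ball c ε, x ∉ T ∧ PairwiseNonparallel (Insert.insert x T) := by
  set I : Finset (Plane × Plane × Plane) := (T ×ˢ T ×ˢ T).filter fun i => i.2.1 ≠ i.2.2 with hI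
  have hd1 : Dense (⋂ i ∈ (I : Set (Plane × Plane × Plane)),
      {x : Plane | cross (x - i.1) (i.2.2 - i.2.1) ≠ 0}) := by
    apply dense_biInter_of_isOpen
    · intro i _
      exact isOpen_ne_fun (continuous_cross (by fun_prop) (by fun_prop)) continuous_const
    · exact I.countable_toSet
    · intro i hi
      exact dense_cross_ne_zero _ (sub_ne_zero.2 (Finset.mem_filter.1 hi).2.symm)
  have hd2 : Dense (⋂ p ∈ (T : Set Plane), {x : Plane | x ≠ p}) := by
    apply dense_biInter_of_isOpen
    · intro i _
      exact isOpen_ne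
    · exact T.countable_toSet
    · intro i _
      exact dense_compl_singleton i
  have hopen : IsOpen (⋂ p ∈ (T : Set Plane), {x : Plane | x ≠ p}) :=
    isOpen_biInter_finset fun _ _ => isOpen_ne
  obtain ⟨x, hx1, hx2, hx3⟩ := (hd1.inter_of_isOpen_right hd2 hopen).inter_open_nonempty _
    Metric.isOpen_ball ⟨c, Metric.mem_ball_self hε⟩
  simp only [Set.mem_iInter] at hx2 hx3
  refine ⟨x, hx1, fun hxT => hx3 x hxT rfl, h.insert ?_⟩
  intro p hp q hq u hu hqu
  exact hx2 (p, q, u) (by simp [hI, hp, hq, hu, hqu])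

theorem PairwiseNonparallel.exists_family {T : Finset Plane} (h : PairwiseNonparallel T)
    [DecidableEq Plane] (c : ℕ → Plane) {ε : ℝ} (hε : 0 < ε) (n : ℕ) :
    ∃ f : ℕ → Plane, (∀ i < n, f i ∈ Metric.ball (c i) ε ∧ f i ∉ T) ∧
      (∀ i < n, ∀ j < n, f i = f j → i = j) ∧
      PairwiseNonparallel (T ∪ (Finset.range n).image f) := by
  induction n with
  | zero => exact ⟨0, by simp, by simp, by simpa using h⟩
  | succ n ih =>
    obtain ⟨f, h1, h2, h3⟩ := ih
    obtain ⟨x, hx1, hx2, hx3⟩ := h3.exists_insert (c n) hε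
    rw [Finset.mem_union, not_or, Finset.mem_image, not_exists] at hx2
    have hlt : ∀ i < n, Function.update f n x i = f i := fun i hi =>
      Function.update_of_ne hi.ne _ _
    have hxf : ∀ i < n, f i ≠ x := fun i hi h => hx2.2 i ⟨Finset.mem_range.2 hi, h⟩
    refine ⟨Function.update f n x, ?_, ?_, ?_⟩
    · intro i hi
      rcases Nat.lt_succ_iff_lt_or_eq.1 hi with hi | rfl
      · rw [hlt i hi]; exact h1 i hi
      · rw [Function.update_self]; exact ⟨hx1, hx2.1⟩
    · intro i hi j hj hij
      rcases Nat.lt_succ_iff_lt_or_eq.1 hi with hi | rfl <;>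
        rcases Nat.lt_succ_iff_lt_or_eq.1 hj with hj | rfl
      · rw [hlt i hi, hlt j hj] at hij; exact h2 i hi j hj hij
      · rw [hlt i hi, Function.update_self] at hij; exact absurd hij (hxf i hi)
      · rw [hlt j hj, Function.update_self] at hij; exact absurd hij.symm (hxf j hj)
      · rfl
    · convert hx3 using 1
      rw [Finset.range_add_one, Finset.image_insert, Function.update_self, Finset.union_insert]
      congr 2
      exact Finset.image_congr fun i hi => hlt i (Finset.mem_range.1 hi)

/-! ### Crossing rays -/

/-- Cramer's rule gives the parameters of the intersection point as quotients by `cross u v`; the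
hypotheses say that both are positive. -/
theorem not_disjoint_ray {p q u v : Plane} (h1 : 0 < cross u v * cross (q - p) v)
    (h2 : 0 < cross u v * cross (q - p) u) : ¬ Disjoint (ray p u) (ray q v) := by
  have hD : cross u v ≠ 0 := by
    intro h
    rw [h, zero_mul] at h1
    exact lt_irrefl _ h1
  have hD2 : 0 < cross u v * cross u v := mul_self_pos.2 hD
  rw [Set.not_disjoint_iff]
  refine ⟨p + (cross (q - p) v / cross u v) • u, ⟨_, ?_, rfl⟩,
    ⟨cross (q - p) u / cross u v, ?_, ?_⟩⟩
  · rw [← mul_div_mul_left _ _ hD]; exact (div_pos h1 hD2).le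
  · rw [← mul_div_mul_left _ _ hD]; exact (div_pos h2 hD2).le
  · refine plane_ext ?_ ?_
    · simp only [PiLp.add_apply, PiLp.smul_apply, smul_eq_mul]
      field_simp
      simp [cross]; ring
    · simp only [PiLp.add_apply, PiLp.smul_apply, smul_eq_mul]
      field_simp
      simp [cross]; ring

theorem ray_subset_ray {z v x : Plane} (hx : x ∈ ray z v) : ray z (x - z) ⊆ ray z v := by
  obtain ⟨t, ht, rfl⟩ := hx
  rintro y ⟨s, hs, rfl⟩
  exact ⟨s * t, mul_nonneg hs ht, by rw [add_sub_cancel_left, smul_smul]⟩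

/-- Near a point `c` not collinear with `z` and `z'`, rays from `z` and `z'` cross. -/
theorem eventually_rays_cross {c z z' : Plane} (h : cross (c - z) (c - z') ≠ 0) :
    ∀ᶠ ε : ℝ in 𝓝[>] 0, ∀ x ∈ Metric.ball c ε, ∀ x' ∈ Metric.ball c ε, ∀ v v' : Plane,
      x ∈ ray z v → x' ∈ ray z' v' → ¬ Disjoint (ray z v) (ray z' v') := by
  -- These are the Cramer conditions for the directions from `z` and `z'`. At `(c, c)` both products
  -- equal the square of `cross (c - z) (c - z')`, and positivity is an open condition.
  have ev : ∀ᶠ y : Plane × Plane in 𝓝 (c, c),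
      0 < cross (y.1 - z) (y.2 - z') * cross (z' - z) (y.2 - z') ∧
      0 < cross (y.1 - z) (y.2 - z') * cross (z' - z) (y.1 - z) := by
    have h0 : 0 < cross (c - z) (c - z') * cross (c - z) (c - z') := mul_self_pos.2 h
    refine Eventually.and ?_ ?_
    · refine ContinuousAt.eventually_lt continuousAt_const (Continuous.continuousAt ?_) ?_
      · exact (continuous_cross (by fun_prop) (by fun_prop)).mul
          (continuous_cross (by fun_prop) (by fun_prop))
      · refine h0.trans_eq ?_
        simp only [cross, PiLp.sub_apply]
        ring
    · refine ContinuousAt.eventually_lt continuousAt_const (Continuous.continuousAt ?_) ?_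
      · exact (continuous_cross (by fun_prop) (by fun_prop)).mul
          (continuous_cross (by fun_prop) (by fun_prop))
      · refine h0.trans_eq ?_
        simp only [cross, PiLp.sub_apply]
        ring
  obtain ⟨r, hr, hball⟩ := Metric.eventually_nhds_iff_ball.1 ev
  filter_upwards [Ioo_mem_nhdsGT hr] with ε hε x hx x' hx' v v' hxv hxv' hdisj
  have := hball (x, x') (by
    rw [← ball_prod_same]
    exact ⟨Metric.ball_subset_ball hε.2.le hx, Metric.ball_subset_ball hε.2.le hx'⟩)
  exact not_disjoint_ray this.1 this.2
    (Set.disjoint_of_subset (ray_subset_ray hxv) (ray_subset_ray hxv') hdisj)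

/-- Rays from points near `c` and `c'`, directed almost to the origin, cross when `c` and `c'`
are not collinear with the origin. -/
theorem eventually_central_rays_cross {c c' : Plane} (h : cross c c' ≠ 0) :
    ∀ᶠ ω : ℝ in 𝓝[>] 0, ∀ p ∈ Metric.ball c ω, ∀ p' ∈ Metric.ball c' ω, ∀ u u' : Plane,
      u ≠ 0 → u' ≠ 0 → |directionAngle u - directionAngle (-c)| < ω →
      |directionAngle u' - directionAngle (-c')| < ω → ¬ Disjoint (ray p u) (ray p' u') := by
  set θ := directionAngle (-c) with hθ
  set θ' := directionAngle (-c') with hθ'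
  have hc0 := len_mul_cos (-c)
  have hc1 := len_mul_sin (-c)
  have hc0' := len_mul_cos (-c')
  have hc1' := len_mul_sin (-c')
  rw [← hθ] at hc0 hc1
  rw [← hθ'] at hc0' hc1'
  have hne : -c ≠ 0 := by
    intro h0
    rw [neg_eq_zero] at h0
    simp [h0, cross] at h
  have hne' : -c' ≠ 0 := by
    intro h0
    rw [neg_eq_zero] at h0
    simp [h0, cross] at h
  have hsin : Real.sin (θ' - θ) ≠ 0 := by
    intro h0
    apply h
    have : cross c c' = cross (-c) (-c') := by simp [cross]
    rw [this, cross_eq_sin, ← hθ, ← hθ', h0, mul_zero]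
  have hsq : 0 < Real.sin (θ' - θ) * Real.sin (θ' - θ) := mul_self_pos.2 hsin
  -- The Cramer conditions, freed of the lengths of the directions, are open in apexes and angles.
  -- In the limit the rays meet at the origin, and both expressions are positive multiples of `sin
  -- (θ' - θ) ^ 2`.
  have ev : ∀ᶠ y : (Plane × Plane) × (ℝ × ℝ) in 𝓝 ((c, c'), (θ, θ')),
      0 < Real.sin (y.2.2 - y.2.1) * ((y.1.2 0 - y.1.1 0) * Real.sin y.2.2 -
        (y.1.2 1 - y.1.1 1) * Real.cos y.2.2) ∧
      0 < Real.sin (y.2.2 - y.2.1) * ((y.1.2 0 - y.1.1 0) * Real.sin y.2.1 -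
        (y.1.2 1 - y.1.1 1) * Real.cos y.2.1) := by
    refine Eventually.and ?_ ?_
    · refine ContinuousAt.eventually_lt continuousAt_const
        (Continuous.continuousAt (by fun_prop)) ?_
      have : Real.sin (θ' - θ) * ((c' 0 - c 0) * Real.sin θ' - (c' 1 - c 1) * Real.cos θ') =
          len (-c) * (Real.sin (θ' - θ) * Real.sin (θ' - θ)) := by
        simp only [PiLp.neg_apply] at hc0 hc1 hc0' hc1'
        rw [Real.sin_sub]
        rw [show c 0 = -(len (-c) * Real.cos θ) by linarith,
          show c 1 = -(len (-c) * Real.sin θ) by linarith,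
          show c' 0 = -(len (-c') * Real.cos θ') by linarith,
          show c' 1 = -(len (-c') * Real.sin θ') by linarith]
        ring
      simp only [this]
      exact mul_pos (len_pos hne) hsq
    · refine ContinuousAt.eventually_lt continuousAt_const
        (Continuous.continuousAt (by fun_prop)) ?_
      have : Real.sin (θ' - θ) * ((c' 0 - c 0) * Real.sin θ - (c' 1 - c 1) * Real.cos θ) =
          len (-c') * (Real.sin (θ' - θ) * Real.sin (θ' - θ)) := by
        simp only [PiLp.neg_apply] at hc0 hc1 hc0' hc1'
        rw [Real.sin_sub]
        rw [show c 0 = -(len (-c) * Real.cos θ) by linarith,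
          show c 1 = -(len (-c) * Real.sin θ) by linarith,
          show c' 0 = -(len (-c') * Real.cos θ') by linarith,
          show c' 1 = -(len (-c') * Real.sin θ') by linarith]
        ring
      simp only [this]
      exact mul_pos (len_pos hne') hsq
  obtain ⟨r, hr, hball⟩ := Metric.eventually_nhds_iff_ball.1 ev
  filter_upwards [Ioo_mem_nhdsGT hr] with ω hω p hp p' hp' u u' hu hu' ha ha'
  have hmem : ((p, p'), (directionAngle u, directionAngle u')) ∈
      Metric.ball ((c, c'), (θ, θ')) r := by
    rw [← ball_prod_same, ← ball_prod_same, ← ball_prod_same]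
    refine ⟨⟨Metric.ball_subset_ball hω.2.le hp, Metric.ball_subset_ball hω.2.le hp'⟩, ?_, ?_⟩
    · rw [Metric.mem_ball, Real.dist_eq]; exact ha.trans hω.2
    · rw [Metric.mem_ball, Real.dist_eq]; exact ha'.trans hω.2
  obtain ⟨h1, h2⟩ := hball _ hmem
  simp only at h1 h2
  have hl := len_pos hu
  have hl' := len_pos hu'
  refine not_disjoint_ray ?_ ?_
  · have : cross u u' * cross (p' - p) u' = len u * len u' * len u' *
        (Real.sin (directionAngle u' - directionAngle u) * ((p' 0 - p 0) *
          Real.sin (directionAngle u') - (p' 1 - p 1) * Real.cos (directionAngle u'))) := by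
      rw [cross_eq_sin, cross, ← len_mul_cos u', ← len_mul_sin u']
      simp only [PiLp.sub_apply]
      ring
    rw [this]
    positivity
  · have : cross u u' * cross (p' - p) u = len u * len u' * len u *
        (Real.sin (directionAngle u' - directionAngle u) * ((p' 0 - p 0) *
          Real.sin (directionAngle u) - (p' 1 - p 1) * Real.cos (directionAngle u))) := by
      rw [cross_eq_sin u u', cross, ← len_mul_cos u, ← len_mul_sin u]
      simp only [PiLp.sub_apply]
      ring
    rw [this]
    positivity


/-! ### Order at infinity of two disjoint rays -/

theorem sin_neg_of_pi_lt {x : ℝ} (h1 : Real.pi < x) (h2 : x < 2 * Real.pi) : Real.sin x < 0 := by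
  have := Real.sin_pos_of_pos_of_lt_pi (x := x - Real.pi) (by linarith) (by linarith)
  rw [Real.sin_sub_pi] at this
  linarith

theorem sin_pos_of_lt_neg_pi {x : ℝ} (h1 : x < -Real.pi) (h2 : -(2 * Real.pi) < x) :
    0 < Real.sin x := by
  have := sin_neg_of_pi_lt (x := -x) (by linarith) (by linarith)
  rw [Real.sin_neg] at this
  linarith

theorem leftOffset_eq {v : Plane} (hv : v ≠ 0) (p : Plane) :
    leftOffset p v = Real.cos (directionAngle v) * p 1 - Real.sin (directionAngle v) * p 0 := by
  have h := len_pos hv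
  rw [leftOffset, ← len_eq_norm, div_eq_iff h.ne']
  nth_rewrite 1 [← len_mul_cos v]
  nth_rewrite 1 [← len_mul_sin v]
  ring

theorem leftOffset_sub_leftOffset {p z u v : Plane} (hu : u ≠ 0) (hv : v ≠ 0)
    (h : directionAngle u = directionAngle v) :
    len v * (leftOffset z v - leftOffset p u) = -cross (z - p) v := by
  rw [leftOffset_eq hu, leftOffset_eq hv, h, cross, ← len_mul_cos v, ← len_mul_sin v]
  simp only [PiLp.sub_apply]
  ring

theorem positionAtInfinity_le_iff {p z u v : Plane} :
    positionAtInfinity p u ≤ positionAtInfinity z v ↔ directionAngle u < directionAngle v ∨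
      directionAngle u = directionAngle v ∧ leftOffset p u ≤ leftOffset z v := by
  rw [positionAtInfinity, positionAtInfinity, Prod.Lex.toLex_le_toLex]

theorem directionAngle_le_of_position_le {p z u v : Plane}
    (h : positionAtInfinity p u ≤ positionAtInfinity z v) :
    directionAngle u ≤ directionAngle v := by
  rcases positionAtInfinity_le_iff.1 h with h | h
  · exact h.le
  · exact h.1.le

section Pair

variable {p z u v : Plane} {θ ω : ℝ}

/-- In the opposite order, `cross u v` and `cross (z - p) u` would be positive too and the rays
would meet; for equal angles the offsets contradict `hB`. The angles lie in one of the sectors left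
of the cut at `π` by removing the angles within `ω` of `θ`. Such a sector may be wider than `π`, so
the signs of the sines need the bounds on `θ ± ω`. -/
theorem position_lt_of_cross_pos (hu : u ≠ 0) (hv : v ≠ 0)
    (hw : |directionAngle (z - p) - θ| < ω) (h1 : -(Real.pi / 2) < θ - ω)
    (h2 : θ + ω < Real.pi / 2) (hαθ : ω ≤ |directionAngle u - θ|)
    (hβθ : ω ≤ |directionAngle v - θ|) (hpart : directionAngle u ≤ θ ↔ directionAngle v ≤ θ)
    (hd : Disjoint (ray p u) (ray z v)) (hB : 0 < cross (z - p) v) :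
    positionAtInfinity z v < positionAtInfinity p u := by
  by_contra hlt
  rw [not_lt] at hlt
  have hle := directionAngle_le_of_position_le hlt
  have hw0 : z - p ≠ 0 := fun h => by simp [h, cross] at hB
  have hlw := len_pos hw0
  have hlu := len_pos hu
  have hlv := len_pos hv
  have hα := directionAngle_mem u
  have hβ := directionAngle_mem v
  have hBs := hB
  rw [cross_eq_sin] at hBs
  have hsin := pos_of_mul_pos_right hBs (by positivity)
  rw [abs_lt] at hw
  have hA : 0 < Real.sin (directionAngle u - directionAngle (z - p)) ∧
      directionAngle v - directionAngle u < Real.pi := by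
    by_cases hu' : directionAngle u ≤ θ
    · have hv' := hpart.1 hu'
      rw [abs_of_nonpos (by linarith)] at hαθ hβθ
      have : directionAngle v - directionAngle (z - p) < -Real.pi := by
        by_contra hge
        rw [not_lt] at hge
        exact absurd hsin (not_lt.2 (Real.sin_nonpos_of_nonpos_of_neg_pi_le (by linarith) hge))
      exact ⟨sin_pos_of_lt_neg_pi (by linarith) (by linarith [hα.1]), by linarith [hα.1]⟩
    · have hv' := mt hpart.2 hu'
      rw [not_le] at hu' hv'
      rw [abs_of_nonneg (by linarith)] at hαθ hβθ
      have : directionAngle v - directionAngle (z - p) < Real.pi := by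
        by_contra hge
        rw [not_lt] at hge
        rcases hge.eq_or_lt with h | h
        · rw [← h, Real.sin_pi] at hsin
          exact lt_irrefl _ hsin
        · exact lt_asymm hsin (sin_neg_of_pi_lt h (by linarith [hβ.2]))
      exact ⟨Real.sin_pos_of_pos_of_lt_pi (by linarith) (by linarith), by linarith⟩
  rcases hle.eq_or_lt with heq | hlt'
  · rcases positionAtInfinity_le_iff.1 hlt with h | h
    · exact absurd heq h.ne
    · have := leftOffset_sub_leftOffset (p := p) (z := z) hu hv heq
      have h' := mul_nonneg hlv.le (sub_nonneg.2 h.2)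
      linarith
  · have hD := Real.sin_pos_of_pos_of_lt_pi (sub_pos.2 hlt') hA.2
    refine not_disjoint_ray ?_ ?_ hd
    · exact mul_pos (by rw [cross_eq_sin]; positivity) hB
    · have := hA.1
      rw [cross_eq_sin u v, cross_eq_sin (z - p) u]
      positivity

theorem position_lt_of_cross_neg (hu : u ≠ 0) (hv : v ≠ 0)
    (hw : |directionAngle (z - p) - θ| < ω) (h1 : -(Real.pi / 2) < θ - ω)
    (h2 : θ + ω < Real.pi / 2) (hαθ : ω ≤ |directionAngle u - θ|)
    (hβθ : ω ≤ |directionAngle v - θ|) (hpart : directionAngle u ≤ θ ↔ directionAngle v ≤ θ)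
    (hd : Disjoint (ray p u) (ray z v)) (hB : cross (z - p) v < 0) :
    positionAtInfinity p u < positionAtInfinity z v := by
  by_contra hlt
  rw [not_lt] at hlt
  have hle := directionAngle_le_of_position_le hlt
  have hw0 : z - p ≠ 0 := fun h => by simp [h, cross] at hB
  have hlw := len_pos hw0
  have hlu := len_pos hu
  have hlv := len_pos hv
  have hα := directionAngle_mem u
  have hβ := directionAngle_mem v
  have hBs := hB
  rw [cross_eq_sin] at hBs
  have hsin := neg_of_mul_neg_right hBs (by positivity)
  rw [abs_lt] at hw
  have hA : Real.sin (directionAngle u - directionAngle (z - p)) < 0 ∧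
      directionAngle u - directionAngle v < Real.pi := by
    by_cases hu' : directionAngle u ≤ θ
    · have hv' := hpart.1 hu'
      rw [abs_of_nonpos (by linarith)] at hαθ hβθ
      have : -Real.pi < directionAngle v - directionAngle (z - p) := by
        by_contra hge
        rw [not_lt] at hge
        rcases hge.eq_or_lt with h | h
        · rw [h, Real.sin_neg, Real.sin_pi, neg_zero] at hsin
          exact lt_irrefl _ hsin
        · exact lt_asymm hsin (sin_pos_of_lt_neg_pi h (by linarith [hβ.1]))
      exact ⟨Real.sin_neg_of_neg_of_neg_pi_lt (by linarith) (by linarith), by linarith⟩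
    · have hv' := mt hpart.2 hu'
      rw [not_le] at hu' hv'
      rw [abs_of_nonneg (by linarith)] at hαθ hβθ
      have : Real.pi < directionAngle v - directionAngle (z - p) := by
        by_contra hge
        rw [not_lt] at hge
        exact absurd hsin (not_lt.2 (Real.sin_nonneg_of_nonneg_of_le_pi (by linarith) hge))
      exact ⟨sin_neg_of_pi_lt (by linarith) (by linarith [hα.2]), by linarith [hα.2]⟩
  rcases hle.eq_or_lt with heq | hlt'
  · rcases positionAtInfinity_le_iff.1 hlt with h | h
    · exact absurd heq h.ne
    · have := leftOffset_sub_leftOffset (p := p) (z := z) hu hv heq.symm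
      have h' := mul_nonneg hlv.le (sub_nonneg.2 h.2)
      linarith
  · have hD := Real.sin_neg_of_neg_of_neg_pi_lt (x := directionAngle v - directionAngle u)
      (by linarith) (by linarith [hA.2])
    have hD' : cross u v < 0 := by
      rw [cross_eq_sin]; exact mul_neg_of_pos_of_neg (by positivity) hD
    have hA' : cross (z - p) u < 0 := by
      rw [cross_eq_sin]; exact mul_neg_of_pos_of_neg (by positivity) hA.1
    exact not_disjoint_ray (mul_pos_of_neg_of_neg hD' hB) (mul_pos_of_neg_of_neg hD' hA') hd

end Pair

theorem directionAngle_smul {r : ℝ} (hr : 0 < r) (v : Plane) :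
    directionAngle (r • v) = directionAngle v := by
  rw [directionAngle, directionAngle, ← Complex.arg_real_mul ⟨v 0, v 1⟩ hr]
  congr 1
  apply Complex.ext <;> simp

/-- Two rays that leave a small disk in the same sector, away from the direction of `z`, are not
separated at infinity by a ray from `z` that misses the disk. -/
theorem not_position_between {c p p' z u u' v : Plane} {ε θ ω : ℝ} (hp : p ∈ Metric.ball c ε)
    (hp' : p' ∈ Metric.ball c ε) (hu : u ≠ 0) (hu' : u' ≠ 0) (hv : v ≠ 0)
    (hw : ∀ x ∈ Metric.ball c ε, |directionAngle (z - x) - θ| < ω)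
    (h1 : -(Real.pi / 2) < θ - ω) (h2 : θ + ω < Real.pi / 2)
    (hαθ : ω ≤ |directionAngle u - θ|) (hαθ' : ω ≤ |directionAngle u' - θ|)
    (hpart : directionAngle u ≤ θ ↔ directionAngle u' ≤ θ)
    (hmiss : ∀ x ∈ Metric.ball c ε, x ∉ ray z v) (hd : Disjoint (ray p u) (ray z v))
    (hd' : Disjoint (ray p' u') (ray z v))
    (hle' : positionAtInfinity p' u' ≤ positionAtInfinity z v)
    (hle : positionAtInfinity z v ≤ positionAtInfinity p u) : False := by
  have ha := directionAngle_le_of_position_le hle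
  have ha' := directionAngle_le_of_position_le hle'
  have hω : 0 < ω := (abs_nonneg _).trans_lt (hw p hp)
  -- The angle of `v` is squeezed between those of `u'` and `u`, hence lies in the same sector.
  have hβ : ω ≤ |directionAngle v - θ| ∧ (directionAngle u ≤ θ ↔ directionAngle v ≤ θ) := by
    by_cases hα : directionAngle u ≤ θ
    · rw [abs_of_nonpos (by linarith)] at hαθ ⊢
      exact ⟨by linarith, fun _ => by linarith, fun _ => hα⟩
    · have hα' := mt hpart.2 hα
      rw [not_le] at hα hα'
      rw [abs_of_nonneg (by linarith)] at hαθ' ⊢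
      exact ⟨by linarith, fun _ => by linarith, fun _ => by linarith⟩
  -- A zero would put `x` on the ray from `z`, or make `v` point from `x` to `z`, within `ω` of the
  -- angle `θ`.
  have hne : ∀ x ∈ Metric.ball c ε, cross (z - x) v ≠ 0 := by
    intro x hx h0
    rw [cross_swap, neg_eq_zero, cross_eq_zero_iff hv] at h0
    obtain ⟨r, hr⟩ := h0
    rcases le_or_gt r 0 with hr0 | hr0
    · refine hmiss x hx ⟨-r, by linarith, ?_⟩
      rw [neg_smul, ← hr]
      abel
    · have := hw x hx
      rw [hr, directionAngle_smul hr0] at this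
      exact absurd this (not_lt.2 hβ.1)
  -- The two orders at infinity force opposite signs at `p'` and `p`; by connectedness the cross
  -- product would vanish inside the disk.
  have hB' : cross (z - p') v < 0 := by
    refine (hne p' hp').lt_or_gt.resolve_right fun h => ?_
    exact not_lt.2 hle' (position_lt_of_cross_pos hu' hv (hw p' hp') h1 h2 hαθ' hβ.1
      (hpart.symm.trans hβ.2) hd' h)
  have hB : 0 < cross (z - p) v := by
    refine (hne p hp).lt_or_gt.resolve_left fun h => ?_
    exact not_lt.2 hle (position_lt_of_cross_neg hu hv (hw p hp) h1 h2 hαθ hβ.1 hβ.2 hd h)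
  have hcont : Continuous fun x : Plane => cross (z - x) v :=
    continuous_cross (by fun_prop) continuous_const
  obtain ⟨x, hx, hx0⟩ := (convex_ball c ε).isPreconnected.intermediate_value hp' hp
    hcont.continuousOn ⟨hB'.le, hB.le⟩
  exact hne x hx hx0

/-! ### A configuration with few alternations -/

/-- The points of `R` lie in `m` tiny disks, at most `m` in each. Seen from the disk around
`c q`, all points of `B` are in almost the direction of the origin. -/
structure ClusterConfiguration (m : ℕ) (R B : Finset Plane) where
  c : Fin m → Plane
  ε : ℝ
  ω : ℝ
  cluster : Plane → Fin m
  index : Plane → Fin m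
  mem_ball : ∀ p ∈ R, p ∈ Metric.ball (c (cluster p)) ε
  inj : ∀ p ∈ R, ∀ q ∈ R, cluster p = cluster q → index p = index q → p = q
  lower : ∀ q, -(Real.pi / 2) < directionAngle (-c q) - ω
  upper : ∀ q, directionAngle (-c q) + ω < Real.pi / 2
  central_cross : ∀ q q', q ≠ q' → ∀ p ∈ Metric.ball (c q) ε, ∀ p' ∈ Metric.ball (c q') ε,
    ∀ u u' : Plane, u ≠ 0 → u' ≠ 0 → |directionAngle u - directionAngle (-c q)| < ω →
      |directionAngle u' - directionAngle (-c q')| < ω → ¬ Disjoint (ray p u) (ray p' u')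
  blue_angle : ∀ q, ∀ z ∈ B, ∀ x ∈ Metric.ball (c q) ε,
    |directionAngle (z - x) - directionAngle (-c q)| < ω
  blue_cross : ∀ q, ∀ z ∈ B, ∀ z' ∈ B, z ≠ z' → ∀ x ∈ Metric.ball (c q) ε,
    ∀ x' ∈ Metric.ball (c q) ε, ∀ v v' : Plane, x ∈ ray z v → x' ∈ ray z' v' →
      ¬ Disjoint (ray z v) (ray z' v')

-- There are `m + m + 2 * m` labels, plus one change for wrapping around. The boolean records the
-- side of the central direction; the other border of each sector is the branch cut, so a sector is
-- an interval in the order at infinity.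
open Classical in
theorem ClusterConfiguration.alternationNumber_le {m : ℕ} {R B : Finset Plane}
    (C : ClusterConfiguration m R B) (hRB : Disjoint R B) {d : Plane → Plane}
    (hd : IsDisjointRaySystem (R ∪ B) d) :
    alternationNumber (circularSequence R B d) ≤ 4 * m + 1 := by
  have hR : ∀ p ∈ R, p ∈ R ∪ B := fun p hp => Finset.mem_union_left _ hp
  have hB : ∀ p ∈ B, p ∈ R ∪ B := fun p hp => Finset.mem_union_right _ hp
  set lab : Plane → Plane → Fin m ⊕ Fin m ⊕ (Fin m × Bool) := fun r b =>
    if h : ∃ q, ∃ x ∈ Metric.ball (C.c q) C.ε, x ∈ ray b (d b) then Sum.inl h.choose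
    else if |directionAngle (d r) - directionAngle (-C.c (C.cluster r))| < C.ω then
      Sum.inr (Sum.inl (C.index r))
    else Sum.inr (Sum.inr (C.cluster r,
      decide (directionAngle (d r) ≤ directionAngle (-C.c (C.cluster r))))) with hlab
  refine (alternationNumber_le_card d lab ?_).trans (by simp; omega)
  intro r hr b hb r' hr' b' hb' hrr hbb hle hle' _ heq
  simp only [hlab] at heq
  by_cases hx : ∃ q, ∃ x ∈ Metric.ball (C.c q) C.ε, x ∈ ray b (d b) <;>
    by_cases hx' : ∃ q, ∃ x ∈ Metric.ball (C.c q) C.ε, x ∈ ray b' (d b')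
  · rw [dif_pos hx, dif_pos hx', Sum.inl.injEq] at heq
    obtain ⟨x, hxb, hxr⟩ := hx.choose_spec
    obtain ⟨x', hxb', hxr'⟩ := hx'.choose_spec
    rw [← heq] at hxb'
    exact C.blue_cross _ b hb b' hb' hbb x hxb x' hxb' _ _ hxr hxr'
      (hd.2 b (hB b hb) b' (hB b' hb') hbb)
  · rw [dif_pos hx, dif_neg hx'] at heq
    split_ifs at heq
  · rw [dif_neg hx, dif_pos hx'] at heq
    split_ifs at heq
  · rw [dif_neg hx, dif_neg hx'] at heq
    split_ifs at heq with hs hs' hs'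
    · rw [Sum.inr.injEq, Sum.inl.injEq] at heq
      -- Distinct red points with equal indices belong to different clusters.
      refine C.central_cross _ _ (fun h => hrr (C.inj r hr r' hr' h heq)) r (C.mem_ball r hr) r'
        (C.mem_ball r' hr') _ _ (hd.1 r (hR r hr)) (hd.1 r' (hR r' hr')) hs hs'
        (hd.2 r (hR r hr) r' (hR r' hr') hrr)
    · cases heq
    · cases heq
    · rw [Sum.inr.injEq, Sum.inr.injEq, Prod.mk.injEq, decide_eq_decide] at heq
      obtain ⟨hcl, hpart⟩ := heq
      have hmem' := C.mem_ball r' hr'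
      rw [← hcl] at hs' hpart hmem'
      have hrb : ∀ p ∈ R, Disjoint (ray p (d p)) (ray b (d b)) := fun p hp =>
        hd.2 p (hR p hp) b (hB b hb) fun h => Finset.disjoint_left.1 hRB hp (h ▸ hb)
      exact not_position_between (C.mem_ball r hr) hmem' (hd.1 r (hR r hr)) (hd.1 r' (hR r' hr'))
        (hd.1 b (hB b hb)) (C.blue_angle _ b hb) (C.lower _) (C.upper _) (not_lt.1 hs)
        (not_lt.1 hs') hpart (fun x hxb hxr => hx ⟨_, x, hxb, hxr⟩) (hrb r hr) (hrb r' hr') hle' hle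


/-! ### Existence of the configuration -/

theorem continuousAt_directionAngle {v : Plane} (hv : 0 < v 0) :
    ContinuousAt directionAngle v := by
  have h : Continuous fun v : Plane => Complex.equivRealProdCLM.symm (v 0, v 1) :=
    Complex.equivRealProdCLM.symm.continuous.comp (by fun_prop)
  exact ContinuousAt.comp (f := fun v : Plane => Complex.equivRealProdCLM.symm (v 0, v 1))
    (Complex.continuousAt_arg (Or.inl hv)) h.continuousAt

theorem abs_directionAngle_lt {v : Plane} (hv : 0 < v 0) : |directionAngle v| < Real.pi / 2 :=
  Complex.abs_arg_lt_pi_div_two_iff.2 (Or.inl hv)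

theorem eventually_angle_near {c : Plane} (hc : 0 < (-c) 0) {ω : ℝ} (hω : 0 < ω) :
    ∀ᶠ ρ : ℝ in 𝓝[>] 0, ∀ z ∈ Metric.ball (0 : Plane) ρ, ∀ x ∈ Metric.ball c ρ,
      |directionAngle (z - x) - directionAngle (-c)| < ω := by
  have hcont : ContinuousAt (fun y : Plane × Plane => directionAngle (y.1 - y.2)) (0, c) := by
    have h1 : ContinuousAt (fun y : Plane × Plane => y.1 - y.2) (0, c) :=
      (continuous_fst.sub continuous_snd).continuousAt
    refine ContinuousAt.comp (g := directionAngle) ?_ h1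
    exact continuousAt_directionAngle (by simpa using hc)
  obtain ⟨r, hr, hball⟩ := Metric.continuousAt_iff.1 hcont ω hω
  filter_upwards [Ioo_mem_nhdsGT hr] with ρ hρ z hz x hx
  have := hball (x := (z, x)) (by
    rw [← Metric.mem_ball, ← ball_prod_same]
    exact ⟨Metric.ball_subset_ball hρ.2.le hz, Metric.ball_subset_ball hρ.2.le hx⟩)
  simpa [Real.dist_eq] using this

/-- Having the origin among the chosen points prevents two centers from being collinear with it.
Staying within distance `1` of `(-1, 0)` makes the directions to the origin point to the right, away
from the branch cut. -/
theorem exists_centers (m : ℕ) : ∃ c : Fin m → Plane, (∀ q, 0 < (-c q) 0) ∧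
    (∀ q q', q ≠ q' → cross (c q) (c q') ≠ 0) ∧
    ∃ T : Finset Plane, (∀ q, c q ∈ T) ∧ PairwiseNonparallel T := by
  classical
  have h0 : PairwiseNonparallel ({0} : Finset Plane) := by
    intro p hp q hq _ _ _ _ hpq
    rw [Finset.mem_singleton] at hp hq
    exact absurd (hp.trans hq.symm) hpq
  obtain ⟨f, h1, h2, h3⟩ := h0.exists_family (fun _ => !₂[-1, 0]) one_pos m
  have hmem : ∀ q : Fin m, f q ∈ ({0} ∪ (Finset.range m).image f : Finset Plane) := fun q =>
    Finset.mem_union_right _ (Finset.mem_image_of_mem _ (Finset.mem_range.2 q.2))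
  have hne : ∀ q : Fin m, 0 ≠ f q := fun q h => (h1 q q.2).2 (by simp [← h])
  refine ⟨fun q => f q, fun q => ?_, fun q q' hqq => ?_, _, hmem, h3⟩
  · have h := (h1 q q.2).1
    rw [Metric.mem_ball, dist_eq_norm] at h
    have h' := (PiLp.norm_apply_le (f q - !₂[-1, 0]) 0).trans_lt h
    rw [Real.norm_eq_abs, abs_lt] at h'
    simp at h' ⊢
    linarith [h'.2]
  · have := h3.cross_ne_zero (Finset.mem_union_left _ (Finset.mem_singleton_self 0)) (hmem q)
      (hmem q') (hne q) (hne q') fun h => hqq (Fin.ext (h2 _ q.2 _ q'.2 h))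
    simpa using this

/-- The scales are chosen in turn: `ω` from the centers, then `ρ` for the blue points, then `ε` once
the blue points are fixed. The centers stay in the nonparallel set, so none is collinear with two
blue points. -/
theorem exists_clusterConfiguration {n m : ℕ} (hm : 0 < m) (hnm : n ≤ m * m) :
    ∃ R B : Finset Plane, R.card = n ∧ B.card = n ∧ Disjoint R B ∧
      StrongGeneralPosition (R ∪ B) ∧ Nonempty (ClusterConfiguration m R B) := by
  classical
  obtain ⟨c, hc, hcc, T, hcT, hT⟩ := exists_centers m
  -- The angular tolerance.
  have ev1 : ∀ᶠ ω : ℝ in 𝓝[>] 0, ∀ q q', q ≠ q' → ∀ p ∈ Metric.ball (c q) ω,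
      ∀ p' ∈ Metric.ball (c q') ω, ∀ u u' : Plane, u ≠ 0 → u' ≠ 0 →
        |directionAngle u - directionAngle (-c q)| < ω →
        |directionAngle u' - directionAngle (-c q')| < ω → ¬ Disjoint (ray p u) (ray p' u') := by
    refine eventually_all.2 fun q => eventually_all.2 fun q' => ?_
    by_cases hq : q = q'
    · exact Eventually.of_forall fun _ h => absurd hq h
    · filter_upwards [eventually_central_rays_cross (hcc q q' hq)] with ω hω _
      exact hω
  have ev2 : ∀ᶠ ω : ℝ in 𝓝[>] 0, ∀ q, -(Real.pi / 2) < directionAngle (-c q) - ω ∧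
      directionAngle (-c q) + ω < Real.pi / 2 := by
    refine eventually_all.2 fun q => ?_
    have := abs_lt.1 (abs_directionAngle_lt (hc q))
    filter_upwards [Ioo_mem_nhdsGT (show 0 < directionAngle (-c q) + Real.pi / 2 by linarith),
      Ioo_mem_nhdsGT (show 0 < Real.pi / 2 - directionAngle (-c q) by linarith)] with ω h1 h2
    exact ⟨by linarith [h1.2], by linarith [h2.2]⟩
  obtain ⟨ω, hω1, hω2, hω⟩ := (ev1.and (ev2.and self_mem_nhdsWithin)).exists
  -- The blue points.
  have ev3 : ∀ᶠ ρ : ℝ in 𝓝[>] 0, ∀ q, ∀ z ∈ Metric.ball (0 : Plane) ρ,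
      ∀ x ∈ Metric.ball (c q) ρ, |directionAngle (z - x) - directionAngle (-c q)| < ω :=
    eventually_all.2 fun q => eventually_angle_near (hc q) hω
  obtain ⟨ρ, hρ1, hρ, hρω⟩ := (ev3.and (Ioo_mem_nhdsGT hω)).exists
  obtain ⟨f, hf1, hf2, hf3⟩ := hT.exists_family (fun _ => 0) hρ n
  have hfT : ∀ j < n, f j ∈ T ∪ (Finset.range n).image f := fun j hj =>
    Finset.mem_union_right _ (Finset.mem_image_of_mem _ (Finset.mem_range.2 hj))
  have hne : ∀ q, ∀ j < n, c q ≠ f j := fun q j hj h => (hf1 j hj).2 (h ▸ hcT q)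
  -- The red points.
  have ev4 : ∀ᶠ ε : ℝ in 𝓝[>] 0, ∀ q, ∀ j j' : Fin n, j ≠ j' → ∀ x ∈ Metric.ball (c q) ε,
      ∀ x' ∈ Metric.ball (c q) ε, ∀ v v' : Plane, x ∈ ray (f j) v → x' ∈ ray (f j') v' →
        ¬ Disjoint (ray (f j) v) (ray (f j') v') := by
    refine eventually_all.2 fun q => eventually_all.2 fun j => eventually_all.2 fun j' => ?_
    by_cases hj : j = j'
    · exact Eventually.of_forall fun _ h => absurd hj h
    · have h0 : cross (c q - f j) (c q - f j') ≠ 0 := by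
        rw [cross_sub_comm, cross_sub_comm', neg_neg]
        exact hf3.cross_ne_zero (Finset.mem_union_left _ (hcT q)) (hfT j j.2) (hfT j' j'.2)
          (hne q j j.2) (hne q j' j'.2) fun h => hj (Fin.ext (hf2 _ j.2 _ j'.2 h))
      filter_upwards [eventually_rays_cross h0] with ε hε _
      exact hε
  obtain ⟨ε, hε1, hε, hερ⟩ := (ev4.and (Ioo_mem_nhdsGT hρ)).exists
  have : NeZero m := ⟨hm.ne'⟩
  -- Red point `i` gets cluster `i / m` and index `i % m`; as `n ≤ m * m`, the quotient is below `m`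
  -- and `Fin.ofNat` leaves it unchanged.
  obtain ⟨g, hg1, hg2, hg3⟩ := hf3.exists_family (fun i => c (Fin.ofNat m (i / m))) hε n
  have hfinj : Set.InjOn f (Finset.range n) := fun i hi j hj =>
    hf2 i (Finset.mem_range.1 hi) j (Finset.mem_range.1 hj)
  have hginj : Set.InjOn g (Finset.range n) := fun i hi j hj =>
    hg2 i (Finset.mem_range.1 hi) j (Finset.mem_range.1 hj)
  have hinv : ∀ i < n, Function.invFunOn g (Finset.range n : Set ℕ) (g i) = i := fun i hi =>
    hginj.leftInvOn_invFunOn (Finset.mem_coe.2 (Finset.mem_range.2 hi))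
  have hball : ∀ q, ∀ x ∈ Metric.ball (c q) ε, x ∈ Metric.ball (c q) ρ := fun q x hx =>
    Metric.ball_subset_ball hερ.le hx
  have hball' : ∀ q, ∀ x ∈ Metric.ball (c q) ε, x ∈ Metric.ball (c q) ω := fun q x hx =>
    Metric.ball_subset_ball (hερ.trans hρω).le hx
  refine ⟨(Finset.range n).image g, (Finset.range n).image f, ?_, ?_, ?_, ?_, ⟨⟨c, ε, ω,
    fun p => Fin.ofNat m (Function.invFunOn g (Finset.range n : Set ℕ) p / m),
    fun p => Fin.ofNat m (Function.invFunOn g (Finset.range n : Set ℕ) p),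
    ?_, ?_, fun q => (hω2 q).1, fun q => (hω2 q).2, ?_, ?_, ?_⟩⟩⟩
  · rw [Finset.card_image_of_injOn hginj, Finset.card_range]
  · rw [Finset.card_image_of_injOn hfinj, Finset.card_range]
  · rw [Finset.disjoint_left]
    rintro _ hx hx'
    obtain ⟨i, hi, rfl⟩ := Finset.mem_image.1 hx
    exact (hg1 i (Finset.mem_range.1 hi)).2 (Finset.mem_union_right _ hx')
  · refine (hg3.mono ?_).strongGeneralPosition
    intro x hx
    simp only [Finset.mem_union] at hx ⊢
    tauto
  · intro p hp
    obtain ⟨i, hi, rfl⟩ := Finset.mem_image.1 hp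
    rw [Finset.mem_range] at hi
    rw [hinv i hi]
    exact (hg1 i hi).1
  · intro p hp p' hp' h1 h2
    obtain ⟨i, hi, rfl⟩ := Finset.mem_image.1 hp
    obtain ⟨j, hj, rfl⟩ := Finset.mem_image.1 hp'
    rw [Finset.mem_range] at hi hj
    rw [hinv i hi, hinv j hj, Fin.ext_iff, Fin.val_ofNat, Fin.val_ofNat] at h1 h2
    rw [Nat.mod_eq_of_lt (Nat.div_lt_of_lt_mul (hi.trans_le hnm)),
      Nat.mod_eq_of_lt (Nat.div_lt_of_lt_mul (hj.trans_le hnm))] at h1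
    rw [← Nat.div_add_mod i m, ← Nat.div_add_mod j m, h1, h2]
  · intro q q' hq p hp p' hp'
    exact hω1 q q' hq p (hball' q p hp) p' (hball' q' p' hp')
  · intro q z hz x hx
    obtain ⟨j, hj, rfl⟩ := Finset.mem_image.1 hz
    exact hρ1 q _ (hf1 j (Finset.mem_range.1 hj)).1 x (hball q x hx)
  · intro q z hz z' hz' hzz x hx x' hx'
    obtain ⟨j, hj, rfl⟩ := Finset.mem_image.1 hz
    obtain ⟨j', hj', rfl⟩ := Finset.mem_image.1 hz'
    exact hε1 q ⟨j, Finset.mem_range.1 hj⟩ ⟨j', Finset.mem_range.1 hj'⟩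
      (fun h => hzz (congrArg f (Fin.mk.inj_iff.1 h))) x hx x' hx'

theorem exists_few_alternations {n : ℕ} (hn : 1 ≤ n) :
    ∃ R B : Finset Plane, R.card = n ∧ B.card = n ∧ Disjoint R B ∧
      StrongGeneralPosition (R ∪ B) ∧ ∀ d : Plane → Plane, IsDisjointRaySystem (R ∪ B) d →
        (alternationNumber (circularSequence R B d) : ℝ) ≤ 10 * Real.sqrt n := by
  -- With `m = Nat.sqrt n + 1` one has `n ≤ m * m`, and `4 * m + 1 ≤ 4 * √n + 5 ≤ 10 * √n`.
  obtain ⟨R, B, hR, hB, hRB, hS, ⟨C⟩⟩ := exists_clusterConfiguration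
    (Nat.succ_pos (Nat.sqrt n)) (Nat.succ_le_succ_sqrt n |>.trans' (Nat.le_succ n))
  refine ⟨R, B, hR, hB, hRB, hS, fun d hd => ?_⟩
  have h : (alternationNumber (circularSequence R B d) : ℝ) ≤ 4 * (Nat.sqrt n + 1) + 1 := by
    exact_mod_cast C.alternationNumber_le hRB hd
  have h1 : (Nat.sqrt n : ℝ) ≤ Real.sqrt n := Real.nat_sqrt_le_real_sqrt
  have h2 : 1 ≤ Real.sqrt n := Real.one_le_sqrt.2 (by exact_mod_cast hn)
  linarith

end ColoredRays

/-! ### The two bounds together -/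

theorem mainTheorem2 :
    (∃ c : ℝ, 0 < c ∧
      ∀ (n : ℕ) (R B : Finset ColoredRays.Plane), 1 ≤ n → R.card = n → B.card = n →
        Disjoint R B → ColoredRays.StrongGeneralPosition (R ∪ B) →
        ∃ d : ColoredRays.Plane → ColoredRays.Plane,
          ColoredRays.IsDisjointRaySystem (R ∪ B) d ∧
          c * Real.sqrt n ≤
            (ColoredRays.alternationNumber (ColoredRays.circularSequence R B d) : ℝ)) ∧
    (∃ K : ℝ, 0 < K ∧
      ∀ n : ℕ, 1 ≤ n →
        ∃ R B : Finset ColoredRays.Plane, R.card = n ∧ B.card = n ∧ Disjoint R B ∧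
          ColoredRays.StrongGeneralPosition (R ∪ B) ∧
          ∀ d : ColoredRays.Plane → ColoredRays.Plane,
            ColoredRays.IsDisjointRaySystem (R ∪ B) d →
            (ColoredRays.alternationNumber (ColoredRays.circularSequence R B d) : ℝ) ≤
              K * Real.sqrt n) := by
  refine ⟨⟨1 / 20, by norm_num, fun n R B hn hR hB hRB hS => ?_⟩,
    ⟨10, by norm_num, fun n hn => ColoredRays.exists_few_alternations hn⟩⟩
  obtain ⟨d, hd, hle⟩ := ColoredRays.exists_raySystem_many_alternations hn hR hB hRB hS
  refine ⟨d, hd, ColoredRays.sqrt_le_alternation ?_ hle⟩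
  exact ColoredRays.one_le_alternationNumber d (Finset.card_pos.1 (by omega))
    (Finset.card_pos.1 (by omega)) hRB
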